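/- Let $G$ be a second countable, locally compact Hausdorff topological groupoid with unit space $G^{(0)}$, range and source maps $r,s$, and $G^x=r^{-1}(x)$ for $x\in G^{(0)}$. Let $\lambda=(\lambda^x)_{x\in G^{(0)}}$ be a (continuous, left) Haar system on $G$: each $\lambda^x$ is a Radon measure with support $G^x$, the function $x\mapsto\int f\,d\lambda^x$ is continuous for every $f\in C_c(G)$, and $\int f(\gamma\gamma')\,d\lambda^{s(\gamma)}(\gamma')=\int f(\gamma')\,d\lambda^{r(\gamma)}(\gamma')$ for all $f\in C_c(G)$ and $\gamma\in G$. A function $\varphi:G\to\mathbb{C}$ is *of positive type* if for all $x\in G^{(0)}$, all $n\ge 1$ and all $\gamma_1,\dots,\gamma_n\in G^x$ the matrix $[\varphi(\gamma_i^{-1}\gamma_j)]_{i,j}$ is positive semidefinite. A *Hilbert bundle* over $G^{(0)}$ is a Banach bundle in the sense of Fell and Doran whose fibres are complex Hilbert spaces: a Hausdorff space $E$ with a continuous open surjection $\pi:E\to G^{(0)}$ and a Hilbert space structure on each fibre $E_x=\pi^{-1}(x)$, such that the norm $E\to\mathbb{R}$, the addition $E\times_{G^{(0)}}E\to E$ and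 the multiplication $E\to E$ by each scalar are continuous, and such that for every $x\in G^{(0)}$ and every net $(b_i)$ in $E$ with $\|b_i\|\to 0$ and $\pi(b_i)\to x$ one has $b_i\to 0_x$. A *(continuous) $G$-Hilbert bundle* is a Hilbert bundle $E$ over $G^{(0)}$ with linear isometries $L(\gamma):E_{s(\gamma)}\to E_{r(\gamma)}$, $\gamma\in G$, such that $L(x)=\mathrm{id}_{E_x}$ for every unit $x$, $L(\gamma\gamma')=L(\gamma)L(\gamma')$ whenever $\gamma\gamma'$ is defined, and $(\gamma,u)\mapsto L(\gamma)u$ is continuous from $\{(\gamma,u)\in G\times E:\pi(u)=s(\gamma)\}$ to $E$. An isomorphism of $G$-Hilbert bundles is a homeomorphism $E\to E'$ over $G^{(0)}$ which restricts to surjective linear isometries $E_x\to E'_x$ and commutes with the actions of $G$. Scalar products $(\cdot\,|\,\cdot)$ are linear in the second variable. **(A)** Let $\varphi:G\to\mathbb{C}$ be a continuous function. The following conditions are equivalent: 1. $\varphi$ is of positive type; 2. for all $f\in C_c(G)$ and all $x\in G^{(0)}$, $$\int\int\varphi(\gamma^{-1}\gamma')\,\overline{f(\gamma)}\,f(\gamma')\,d\lambda^x(\gamma)\,d\lambda^x(\gamma')\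 \ge 0;$$ 3. there exist a continuous $G$-Hilbert bundle $E$ and a continuous section $e:G^{(0)}\to E$ such that $\varphi(\gamma)=(e(r(\gamma))\,|\,L(\gamma)e(s(\gamma)))$ for all $\gamma\in G$. **(B)** Let $\varphi:G\to\mathbb{C}$ be a continuous function of positive type. Then: 1. there exist a continuous $G$-Hilbert bundle $E$ and a continuous section $e:G^{(0)}\to E$ such that (a) $\varphi(\gamma)=(e(r(\gamma))\,|\,L(\gamma)e(s(\gamma)))$ for all $\gamma\in G$, and (b) for all $x\in G^{(0)}$ the linear span of $\{L(\gamma)e(s(\gamma)):\gamma\in G^x\}$ is dense in $E_x$; 2. if $(E,e)$ and $(E',e')$ both satisfy the conditions of (1), there is a unique isomorphism of $G$-Hilbert bundles $u:E\to E'$ such that $e'=u\circ e$. -/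

import Mathlib

open CategoryTheory MeasureTheory Filter Topology
open scoped ComplexOrder

universe u v w w₁ w₂

/-! ### Topological groupoids

A groupoid is a category in which all arrows are invertible. For an arrow `γ : x ⟶ y` we put
`s(γ) = x` and `r(γ) = y`, so that the product `γ γ'` (defined when `s(γ) = r(γ')`)
is the composition `γ' ≫ γ`. The unit space is the type `X` of objects. -/

/-- The set `G` of all arrows of a groupoid with unit space `X`. -/
structure Arr (X : Type u) [Groupoid.{v} X] where
  /-- the source `s(γ)` -/
  source : X
  /-- the range `r(γ)` -/
  range : X
  /-- the arrow itself -/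
  hom : source ⟶ range

/-- The arrow `γ : x ⟶ y`, as an element of the set of all arrows. -/
def toArr {X : Type u} [Groupoid.{v} X] {x y : X} (γ : x ⟶ y) : Arr X := ⟨x, y, γ⟩

/-- The set `G⁽²⁾` of composable pairs `(γ, γ')`, `s(γ) = r(γ')`. -/
structure ComposablePair (X : Type u) [Groupoid.{v} X] where
  /-- the source of `γ'` -/
  start : X
  /-- the range of `γ'`, which is the source of `γ` -/
  mid : X
  /-- the range of `γ` -/
  finish : X
  /-- the arrow `γ` -/
  fst : mid ⟶ finish
  /-- the arrow `γ'` -/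
  snd : start ⟶ mid

/-- `G⁽²⁾` carries the subspace topology of `G × G`. -/
instance {X : Type u} [Groupoid.{v} X] [TopologicalSpace (Arr X)] :
    TopologicalSpace (ComposablePair X) :=
  TopologicalSpace.induced (fun p => (toArr p.fst, toArr p.snd)) inferInstance

/-- Topological groupoids. Source, range and the unit map being continuous, the unit map
identifies `X` with the subspace of units of `G`. -/
class IsTopologicalGroupoid (X : Type u) [TopologicalSpace X] [Groupoid.{v} X]
    [TopologicalSpace (Arr X)] : Prop where
  continuous_source : Continuous (fun γ : Arr X => γ.source)
  continuous_range : Continuous (fun γ : Arr X => γ.range)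
  continuous_unit : Continuous (fun x : X => toArr (𝟙 x))
  continuous_inv : Continuous (fun γ : Arr X => toArr (Groupoid.inv γ.hom))
  continuous_mul : Continuous (fun p : ComposablePair X => toArr (p.snd ≫ p.fst))

/-- The set `G^x = r⁻¹(x)`. -/
structure RangeFiber {X : Type u} [Groupoid.{v} X] (x : X) where
  /-- the source of the arrow -/
  source : X
  /-- the arrow -/
  hom : source ⟶ x

/-- `G^x` carries the subspace topology of `G`. -/
instance {X : Type u} [Groupoid.{v} X] [TopologicalSpace (Arr X)] (x : X) :
    TopologicalSpace (RangeFiber x) :=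
  TopologicalSpace.induced (fun γ => toArr γ.hom) inferInstance

instance {X : Type u} [Groupoid.{v} X] [TopologicalSpace (Arr X)] (x : X) :
    MeasurableSpace (RangeFiber x) := borel _

instance {X : Type u} [Groupoid.{v} X] [TopologicalSpace (Arr X)] (x : X) :
    BorelSpace (RangeFiber x) := ⟨rfl⟩

/-- The product `γ⁻¹ γ'`, for `γ, γ' ∈ G^x`. -/
def invMul {X : Type u} [Groupoid.{v} X] {x : X} (γ γ' : RangeFiber x) : Arr X :=
  toArr (γ'.hom ≫ Groupoid.inv γ.hom)

/-- A (continuous, left) Haar system: Radon measures `λ^x` on `G^x` with support `G^x`, such that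
`x ↦ ∫ f dλ^x` is continuous and `∫ f(γγ') dλ^{s(γ)}(γ') = ∫ f(γ') dλ^{r(γ)}(γ')` for all
`f ∈ C_c(G)` and `γ ∈ G`. -/
structure HaarSystem (X : Type u) [TopologicalSpace X] [Groupoid.{v} X]
    [TopologicalSpace (Arr X)] where
  /-- the measure `λ^x` on `G^x` -/
  measure : ∀ x : X, Measure (RangeFiber x)
  regular : ∀ x, (measure x).Regular
  full_support : ∀ x, (measure x).IsOpenPosMeasure
  continuous_integral : ∀ f : CompactlySupportedContinuousMap (Arr X) ℂ,
    Continuous (fun x => ∫ γ, f (toArr γ.hom) ∂(measure x))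
  left_invariant : ∀ (f : CompactlySupportedContinuousMap (Arr X) ℂ) (x y : X) (γ : x ⟶ y),
    ∫ γ', f (toArr (γ'.hom ≫ γ)) ∂(measure x) = ∫ γ', f (toArr γ'.hom) ∂(measure y)

/-! ### Positive type -/

/-- A kernel `k : Y × Y → ℂ` is of positive type if all the matrices `[k (y i) (y j)]` are
positive semidefinite. -/
def IsPositiveTypeKernel {Y : Type*} (k : Y → Y → ℂ) : Prop :=
  ∀ (n : ℕ) (y : Fin n → Y), (Matrix.of fun i j => k (y i) (y j)).PosSemidef

/-- A function `φ` on `G` is of positive type if, for every unit `x`, the kernel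
`(γ, γ') ↦ φ(γ⁻¹γ')` on `G^x` is. -/
def IsPositiveType {X : Type u} [Groupoid.{v} X] (φ : Arr X → ℂ) : Prop :=
  ∀ x : X, IsPositiveTypeKernel (fun γ γ' : RangeFiber x => φ (invMul γ γ'))

/-! ### Hilbert bundles -/

/-- The total space `∐ E_x` of a family of sets, without a topology. -/
structure BundleSpace {X : Type u} (E : X → Type w) where
  /-- the base point -/
  pt : X
  /-- the vector in the fibre over the base point -/
  vec : E pt

/-- A (continuous) Hilbert bundle over `X`, i.e. a Banach bundle in the sense of Fell and Doran
whose fibres are complex Hilbert spaces. Local triviality is not required. -/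
structure HilbertBundle (X : Type u) [TopologicalSpace X] where
  /-- the fibres `E_x` -/
  fiber : X → Type w
  [normed : ∀ x, NormedAddCommGroup (fiber x)]
  [innerProduct : ∀ x, InnerProductSpace ℂ (fiber x)]
  [complete : ∀ x, CompleteSpace (fiber x)]
  /-- the topology of the total space -/
  [topology : TopologicalSpace (BundleSpace fiber)]
  t2 : T2Space (BundleSpace fiber)
  continuous_proj : Continuous (fun p : BundleSpace fiber => p.pt)
  isOpenMap_proj : IsOpenMap (fun p : BundleSpace fiber => p.pt)
  continuous_norm : Continuous (fun p : BundleSpace fiber => ‖p.vec‖)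
  /-- addition is continuous on the fibre product `E ×_X E` (a subspace of `E × E`) -/
  continuous_add : Continuous[TopologicalSpace.induced
      (fun q : (Σ x : X, fiber x × fiber x) =>
        ((⟨q.1, q.2.1⟩, ⟨q.1, q.2.2⟩) : BundleSpace fiber × BundleSpace fiber))
      inferInstance, topology]
    (fun q : (Σ x : X, fiber x × fiber x) => (⟨q.1, q.2.1 + q.2.2⟩ : BundleSpace fiber))
  continuous_smul : ∀ c : ℂ,
    Continuous (fun p : BundleSpace fiber => (⟨p.pt, c • p.vec⟩ : BundleSpace fiber))
  /-- if `‖b_i‖ → 0` and the base points of `b_i` tend to `x`, then `b_i → 0_x` -/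
  le_nhds_zero : ∀ (x : X) (l : Filter (BundleSpace fiber)), Tendsto (fun p => p.pt) l (𝓝 x) →
    Tendsto (fun p => ‖p.vec‖) l (𝓝 0) → l ≤ 𝓝 ⟨x, 0⟩

attribute [instance] HilbertBundle.normed HilbertBundle.innerProduct HilbertBundle.complete
  HilbertBundle.topology

/-- A (continuous) `G`-Hilbert bundle: a Hilbert bundle over the unit space of `G` with an action
of `G` by linear isometries `L(γ) : E_{s(γ)} → E_{r(γ)}`, such that the map
`(γ, u) ↦ L(γ) u` from `G * E = {(γ, u) : u ∈ E_{s(γ)}}`, a subspace of `G × E`, to `E`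
is continuous. -/
structure GHilbertBundle (X : Type u) [TopologicalSpace X] [Groupoid.{v} X]
    [TopologicalSpace (Arr X)] extends HilbertBundle.{u, w} X where
  /-- the linear isometry `L(γ)` -/
  L : ∀ {x y : X}, (x ⟶ y) → (fiber x →ₗᵢ[ℂ] fiber y)
  L_unit : ∀ (x : X) (u : fiber x), L (𝟙 x) u = u
  L_mul : ∀ {x y z : X} (γ : y ⟶ z) (γ' : x ⟶ y) (u : fiber x), L (γ' ≫ γ) u = L γ (L γ' u)
  continuous_action : Continuous[TopologicalSpace.induced
      (fun q : (Σ γ : Arr X, fiber γ.source) =>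
        ((q.1, ⟨q.1.source, q.2⟩) : Arr X × BundleSpace fiber)) inferInstance, topology]
    (fun q : (Σ γ : Arr X, fiber γ.source) => (⟨q.1.range, L q.1.hom q.2⟩ : BundleSpace fiber))

/-- Continuity of a section of a Hilbert bundle. -/
def IsContinuousSection {X : Type u} [TopologicalSpace X] (E : HilbertBundle.{u, w} X)
    (e : ∀ x, E.fiber x) : Prop :=
  Continuous (fun x => (⟨x, e x⟩ : BundleSpace E.fiber))

/-- Isomorphisms of `G`-Hilbert bundles: equivariant homeomorphisms of the total spaces that
restrict to surjective linear isometries `E_x → E'_x`. -/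
structure GHilbertBundle.Iso {X : Type u} [TopologicalSpace X] [Groupoid.{v} X]
    [TopologicalSpace (Arr X)] (E : GHilbertBundle.{u, v, w₁} X)
    (E' : GHilbertBundle.{u, v, w₂} X) where
  /-- the restriction to the fibres over `x` -/
  map : ∀ x : X, E.fiber x ≃ₗᵢ[ℂ] E'.fiber x
  continuous_map :
    Continuous (fun p : BundleSpace E.fiber => (⟨p.pt, map p.pt p.vec⟩ : BundleSpace E'.fiber))
  continuous_symm :
    Continuous (fun p : BundleSpace E'.fiber => (⟨p.pt, (map p.pt).symm p.vec⟩ : BundleSpace E.fiber))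
  equivariant : ∀ {x y : X} (γ : x ⟶ y) (u : E.fiber x), map y (E.L γ u) = E'.L γ (map x u)

/-- `e` is a continuous section of the `G`-Hilbert bundle `E`, and
`φ(γ) = (e(r(γ)) | L(γ) e(s(γ)))` for all `γ`. The scalar product is linear in its second
variable. -/
def Represents {X : Type u} [TopologicalSpace X] [Groupoid.{v} X] [TopologicalSpace (Arr X)]
    (φ : Arr X → ℂ) (E : GHilbertBundle.{u, v, w} X) (e : ∀ x, E.fiber x) : Prop :=
  IsContinuousSection E.toHilbertBundle e ∧
    ∀ γ : Arr X, φ γ = inner ℂ (e γ.range) (E.L γ.hom (e γ.source))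

/-- For all `x`, the linear span of `{L(γ) e(s(γ)) : γ ∈ G^x}` is dense in `E_x`. -/
def IsTotalSection {X : Type u} [TopologicalSpace X] [Groupoid.{v} X] [TopologicalSpace (Arr X)]
    (E : GHilbertBundle.{u, v, w} X) (e : ∀ x, E.fiber x) : Prop :=
  ∀ x : X, Dense (Submodule.span ℂ
    (Set.range fun γ : RangeFiber x => E.L γ.hom (e γ.source)) : Set (E.fiber x))

/-! ### Kernels of positive type -/

/-! The proof is a GNS construction carried out over each unit and then glued. If `φ` is of positive
type, the kernel `φ(γ⁻¹γ')` on `G^x` is the Gram kernel of a total family `a_x(γ)` in a Hilbert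
space `H_x`. Left translation preserves `γ⁻¹γ'`, so it induces isometries `L(γ) : H_{s(γ)} →
H_{r(γ)}`. With `e(x) = a_x(x)` one gets `a_x(γ) = L(γ) e(s(γ))`, and `φ` is the resulting
coefficient.

What is left is the topology. The sections `ξ_f(x) = ∫ f(γ) a_x(γ) dλ^x(γ)`, for `f ∈ C_c(G)`, are
fibrewise dense, because `λ^x` has full support and `f` can be concentrated near any point. Their
norms are continuous, because their inner products are double integrals of `φ` and integration along
a Haar system preserves continuity in parameters (`HaarSystem.continuous_integral_mul`). Such a
space of sections defines a Hilbert bundle (`HilbertBundle.ofSections`).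

This topology is forced: a Hilbert bundle is determined by the distances to a fibrewise dense space
of sections (`HilbertBundle.topology_eq_sectionTopology`). For two pairs `(E, e)` and `(E', e')`,
the equality of Gram kernels gives unique fibrewise isometries; these carry `ξ_f` to `ξ'_f`, hence
are bicontinuous.

The integral condition says that `‖ξ_f(x)‖² ≥ 0`; conversely, testing it on combinations of
approximate Dirac masses recovers the positivity of the matrices. -/

section Kernel

variable {Y : Type*}

/-- Over `ℂ` no Hermitian hypothesis is needed: a form with real values on the diagonal is Hermitian
by polarization. -/
lemma Matrix.posSemidef_of_dotProduct_mulVec_nonneg {n : Type*} [Fintype n] {M : Matrix n n ℂ}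
    (h : ∀ x : n → ℂ, 0 ≤ star x ⬝ᵥ M.mulVec x) : M.PosSemidef := by
  classical
  rw [← Matrix.isPositive_toEuclideanLin_iff, LinearMap.isPositive_iff_complex]
  intro x
  have h2 := h x.ofLp
  have h3 : inner ℂ (Matrix.toEuclideanLin M x) x = star (star x.ofLp ⬝ᵥ M.mulVec x.ofLp) := by
    rw [← inner_conj_symm]
    simp [EuclideanSpace.inner_eq_star_dotProduct, dotProduct_comm]
  rw [h3]
  obtain ⟨h4, h5⟩ := Complex.nonneg_iff.1 h2
  refine ⟨?_, by simpa using h4⟩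
  apply Complex.ext <;> simp [← h5]

lemma isPositiveTypeKernel_inner {H : Type*} [SeminormedAddCommGroup H] [InnerProductSpace ℂ H]
    {k : Y → Y → ℂ} (v : Y → H) (hk : ∀ y z, k y z = inner ℂ (v y) (v z)) :
    IsPositiveTypeKernel k := by
  intro n y
  have h : (Matrix.of fun i j => k (y i) (y j)) = Matrix.gram ℂ fun i => v (y i) := by
    ext i j
    simp [Matrix.gram, hk]
  rw [h]
  exact Matrix.posSemidef_gram ℂ fun i => v (y i)

/-- Formal linear combinations of the points of `Y`, with the seminorm given by a kernel. -/
def KernelSpan (k : Y → Y → ℂ) (_ : IsPositiveTypeKernel k) : Type _ := Y →₀ ℂ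

variable {k : Y → Y → ℂ}

lemma IsPositiveTypeKernel.conj_symm (hk : IsPositiveTypeKernel k) (y z : Y) :
    (starRingEnd ℂ) (k z y) = k y z := by
  simpa using congrFun (congrFun (hk 2 ![y, z]).1 0) 1

/-- Enumerating the support turns the sum into the quadratic form of one of the matrices of the
kernel. -/
lemma IsPositiveTypeKernel.sum_nonneg (hk : IsPositiveTypeKernel k) (c : Y →₀ ℂ) :
    0 ≤ c.sum fun y a => c.sum fun z b => (starRingEnd ℂ) a * b * k y z := by
  have e := c.support.equivFin.symm
  have h := (hk c.support.card fun i => (e i : Y)).dotProduct_mulVec_nonneg fun i => c (e i)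
  convert h using 1
  simp only [Finsupp.sum, dotProduct, Matrix.mulVec, Pi.star_apply, Finset.mul_sum, Matrix.of_apply]
  rw [← Finset.sum_coe_sort, ← e.sum_comp]
  refine Finset.sum_congr rfl fun i _ => ?_
  rw [← Finset.sum_coe_sort, ← e.sum_comp]
  refine Finset.sum_congr rfl fun j _ => ?_
  simp only [RCLike.star_def]
  ring

noncomputable instance (hk : IsPositiveTypeKernel k) : AddCommGroup (KernelSpan k hk) :=
  inferInstanceAs (AddCommGroup (Y →₀ ℂ))

noncomputable instance (hk : IsPositiveTypeKernel k) : Module ℂ (KernelSpan k hk) :=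
  inferInstanceAs (Module ℂ (Y →₀ ℂ))

/-- The semi-inner product on `KernelSpan k hk`. -/
@[reducible]
noncomputable def KernelSpan.core (hk : IsPositiveTypeKernel k) :
    PreInnerProductSpace.Core ℂ (KernelSpan k hk) where
  inner c d := Finsupp.sum (M := ℂ) (N := ℂ) c fun y a =>
    Finsupp.sum (M := ℂ) d fun z b => (starRingEnd ℂ) a * b * k y z
  conj_inner_symm c d := by
    simp only [Finsupp.sum, map_sum, map_mul, Complex.conj_conj, hk.conj_symm]
    rw [Finset.sum_comm]
    refine Finset.sum_congr rfl fun _ _ => Finset.sum_congr rfl fun _ _ => by ring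
  re_inner_nonneg c := (Complex.nonneg_iff.1 (hk.sum_nonneg c)).1
  add_left c d f := by
    refine Finsupp.sum_add_index' (fun y => by simp [Finsupp.sum]) fun y a b => ?_
    simp only [Finsupp.sum, ← Finset.sum_add_distrib, map_add, add_mul]
  smul_left c d r := by
    refine (Finsupp.sum_smul_index fun y => by simp [Finsupp.sum]).trans ?_
    simp only [Finsupp.sum, Finset.mul_sum, map_mul, mul_assoc]

noncomputable instance (hk : IsPositiveTypeKernel k) : SeminormedAddCommGroup (KernelSpan k hk) :=
  @InnerProductSpace.Core.toSeminormedAddCommGroup ℂ _ _ _ _ (KernelSpan.core hk)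

noncomputable instance (hk : IsPositiveTypeKernel k) : InnerProductSpace ℂ (KernelSpan k hk) :=
  InnerProductSpace.ofCore (KernelSpan.core hk)

/-- The Hilbert space of a kernel of positive type. -/
def KernelSpace (k : Y → Y → ℂ) (hk : IsPositiveTypeKernel k) : Type _ :=
  UniformSpace.Completion (KernelSpan k hk)

noncomputable instance (hk : IsPositiveTypeKernel k) : NormedAddCommGroup (KernelSpace k hk) :=
  inferInstanceAs (NormedAddCommGroup (UniformSpace.Completion (KernelSpan k hk)))

noncomputable instance (hk : IsPositiveTypeKernel k) : InnerProductSpace ℂ (KernelSpace k hk) :=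
  UniformSpace.Completion.innerProductSpace (E := KernelSpan k hk)

instance (hk : IsPositiveTypeKernel k) : CompleteSpace (KernelSpace k hk) :=
  inferInstanceAs (CompleteSpace (UniformSpace.Completion (KernelSpan k hk)))

/-- The formal linear combinations, mapped to the Hilbert space of the kernel. -/
noncomputable def KernelSpace.ofFinsupp (hk : IsPositiveTypeKernel k) :
    (Y →₀ ℂ) →ₗ[ℂ] KernelSpace k hk :=
  (UniformSpace.Completion.toComplₗᵢ (𝕜 := ℂ) (E := KernelSpan k hk)).toLinearMap

/-- The canonical vectors of the Hilbert space of a kernel. -/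
noncomputable def kernelVec (hk : IsPositiveTypeKernel k) (y : Y) : KernelSpace k hk :=
  KernelSpace.ofFinsupp hk (Finsupp.single y 1)

lemma inner_kernelVec (hk : IsPositiveTypeKernel k) (y z : Y) :
    inner ℂ (kernelVec hk y) (kernelVec hk z) = k y z := by
  refine (UniformSpace.Completion.inner_coe (𝕜 := ℂ) (E := KernelSpan k hk) _ _).trans ?_
  refine (Finsupp.sum_single_index (by simp)).trans ?_
  refine (Finsupp.sum_single_index (by simp)).trans ?_
  simp

lemma dense_span_kernelVec (hk : IsPositiveTypeKernel k) :
    Dense (Submodule.span ℂ (Set.range (kernelVec hk)) : Set (KernelSpace k hk)) := by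
  have h : DenseRange (KernelSpace.ofFinsupp hk) :=
    UniformSpace.Completion.denseRange_coe (α := KernelSpan k hk)
  refine h.mono ?_
  rintro _ ⟨c, rfl⟩
  rw [← Finsupp.sum_single c, map_finsuppSum]
  refine Submodule.sum_mem _ fun y _ => ?_
  change KernelSpace.ofFinsupp hk (Finsupp.single y (c y)) ∈ _
  rw [← mul_one (c y), ← smul_eq_mul, ← Finsupp.smul_single, map_smul]
  exact Submodule.smul_mem _ _ (Submodule.subset_span ⟨y, rfl⟩)

end Kernel

/-! ### Isometries determined by Gram kernels -/

section Isometry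

variable {Y : Type*} {H H' : Type*} [NormedAddCommGroup H] [InnerProductSpace ℂ H]
  [NormedAddCommGroup H'] [InnerProductSpace ℂ H']

lemma inner_linearCombination (v : Y → H) (c : Y →₀ ℂ) :
    inner ℂ (Finsupp.linearCombination ℂ v c) (Finsupp.linearCombination ℂ v c) =
      c.sum fun y a => c.sum fun z b => (starRingEnd ℂ) a * (b * inner ℂ (v y) (v z)) := by
  simp only [Finsupp.linearCombination_apply, Finsupp.sum, sum_inner, inner_sum, inner_smul_left,
    inner_smul_right, Finset.mul_sum]
  rw [Finset.sum_comm]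
  refine Finset.sum_congr rfl fun _ _ => Finset.sum_congr rfl fun _ _ => by ring

lemma norm_linearCombination_eq {v : Y → H} {v' : Y → H'}
    (h : ∀ y z, inner ℂ (v' y) (v' z) = inner ℂ (v y) (v z)) (c : Y →₀ ℂ) :
    ‖Finsupp.linearCombination ℂ v' c‖ = ‖Finsupp.linearCombination ℂ v c‖ := by
  rw [@norm_eq_sqrt_re_inner ℂ, @norm_eq_sqrt_re_inner ℂ, inner_linearCombination,
    inner_linearCombination]
  simp only [h]

lemma denseRange_linearCombination {v : Y → H}
    (hv : Dense (Submodule.span ℂ (Set.range v) : Set H)) :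
    DenseRange (Finsupp.linearCombination ℂ v) := by
  rwa [DenseRange, ← LinearMap.coe_range, Finsupp.range_linearCombination]

/-- Two total families with the same Gram kernel are intertwined by an isometry. -/
lemma exists_linearIsometryEquiv [CompleteSpace H] [CompleteSpace H'] {v : Y → H} {v' : Y → H'}
    (hv : Dense (Submodule.span ℂ (Set.range v) : Set H))
    (hv' : Dense (Submodule.span ℂ (Set.range v') : Set H'))
    (h : ∀ y z, inner ℂ (v' y) (v' z) = inner ℂ (v y) (v z)) :
    ∃ U : H ≃ₗᵢ[ℂ] H', ∀ y, U (v y) = v' y := by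
  -- Both spaces are completions of `Y →₀ ℂ` for the same seminorm, so the identity of `Y →₀ ℂ`
  -- extends.
  refine ⟨LinearEquiv.extendOfIsometry (LinearEquiv.refl ℂ (Y →₀ ℂ))
    (Finsupp.linearCombination ℂ v) (Finsupp.linearCombination ℂ v')
    (denseRange_linearCombination hv) (denseRange_linearCombination hv')
    (norm_linearCombination_eq h), fun y => ?_⟩
  have := LinearEquiv.extendOfIsometry_eq (LinearEquiv.refl ℂ (Y →₀ ℂ))
    (Finsupp.linearCombination ℂ v) (Finsupp.linearCombination ℂ v')
    (denseRange_linearCombination hv) (denseRange_linearCombination hv')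
    (norm_linearCombination_eq h) (Finsupp.single y 1)
  simpa using this

lemma LinearIsometry.eq_of_dense_span {v : Y → H}
    (hv : Dense (Submodule.span ℂ (Set.range v) : Set H)) {S T : H →ₗᵢ[ℂ] H'}
    (h : ∀ y, S (v y) = T (v y)) (u : H) : S u = T u := by
  refine congrFun (S.continuous.ext_on hv T.continuous fun w hw => ?_) u
  exact LinearMap.eqOn_span (f := S.toLinearMap) (g := T.toLinearMap)
    (by rintro _ ⟨y, rfl⟩; exact h y) hw

end Isometry

/-! ### Hilbert bundles defined by a vector space of sections -/

section SectionTopology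

variable {X : Type u} [TopologicalSpace X] {V : Type*} [AddCommGroup V] [Module ℂ V]
  {H : X → Type w} [∀ x, NormedAddCommGroup (H x)] [∀ x, InnerProductSpace ℂ (H x)]

/-- The topology on the total space defined by a space of sections `ξ f`: the coarsest one for
which the projection and the distances to the sections are continuous. -/
@[reducible]
def sectionTopology (ξ : V →ₗ[ℂ] ∀ x, H x) : TopologicalSpace (BundleSpace H) :=
  TopologicalSpace.induced (fun p => (p.pt, fun f => ‖p.vec - ξ f p.pt‖)) inferInstance

variable (ξ : V →ₗ[ℂ] ∀ x, H x)

lemma continuous_induced_sectionTopology :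
    Continuous[sectionTopology ξ, _]
      (fun p : BundleSpace H => (p.pt, fun f => ‖p.vec - ξ f p.pt‖)) :=
  continuous_induced_dom

lemma continuous_proj_sectionTopology :
    Continuous[sectionTopology ξ, _] (fun p : BundleSpace H => p.pt) :=
  let := sectionTopology ξ
  (continuous_induced_sectionTopology ξ).fst

lemma continuous_dist_sectionTopology (f : V) :
    Continuous[sectionTopology ξ, _] (fun p : BundleSpace H => ‖p.vec - ξ f p.pt‖) :=
  let := sectionTopology ξ
  (continuous_apply f).comp (continuous_induced_sectionTopology ξ).snd

lemma continuous_sectionTopology {T : Type*} [TopologicalSpace T] {F : T → BundleSpace H}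
    (hp : Continuous fun t => (F t).pt)
    (hF : ∀ f, Continuous fun t => ‖(F t).vec - ξ f (F t).pt‖) :
    Continuous[_, sectionTopology ξ] F :=
  continuous_induced_rng.2 (hp.prodMk (continuous_pi hF))

variable {ξ}

/-- A single section close to both `u` and `F t` controls the distances to all other sections `g`:
up to two errors below `ε / 3`, they are `‖ξ (f - g)‖`, which is continuous on the base. -/
lemma tendsto_sectionTopology (hξ : ∀ f, Continuous fun x => ‖ξ f x‖) {T : Type*} {l : Filter T}
    {F : T → BundleSpace H} {u : BundleSpace H} (hp : Tendsto (fun t => (F t).pt) l (𝓝 u.pt))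
    (hF : ∀ ε > 0, ∃ f, ‖u.vec - ξ f u.pt‖ < ε ∧ ∀ᶠ t in l, ‖(F t).vec - ξ f (F t).pt‖ < ε) :
    Tendsto F l (@nhds _ (sectionTopology ξ) u) := by
  rw [sectionTopology, nhds_induced, tendsto_comap_iff, nhds_prod_eq]
  refine hp.prodMk (tendsto_pi_nhds.2 fun g => Metric.tendsto_nhds.2 fun ε hε => ?_)
  obtain ⟨f, hu, hf⟩ := hF (ε / 3) (by positivity)
  have h := Metric.tendsto_nhds.1 (((hξ (f - g)).tendsto u.pt).comp hp) (ε / 3) (by positivity)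
  filter_upwards [hf, h] with t h1 h2
  simp only [Function.comp, map_sub, Pi.sub_apply, Real.dist_eq] at h2 ⊢
  have h3 := abs_norm_sub_norm_le ((F t).vec - ξ g (F t).pt) (ξ f (F t).pt - ξ g (F t).pt)
  have h4 := abs_norm_sub_norm_le (u.vec - ξ g u.pt) (ξ f u.pt - ξ g u.pt)
  rw [sub_sub_sub_cancel_right] at h3 h4
  rw [abs_lt] at h2 ⊢
  rw [abs_le] at h3 h4
  constructor <;> linarith [h2.1, h2.2, h3.1, h3.2, h4.1, h4.2]

lemma continuous_section_sectionTopology (hξ : ∀ f, Continuous fun x => ‖ξ f x‖) (f : V) :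
    Continuous[_, sectionTopology ξ] (fun x => (⟨x, ξ f x⟩ : BundleSpace H)) :=
  continuous_sectionTopology ξ continuous_id fun g => by simpa using hξ (f - g)

/-- An open set meeting a fibre contains, by density, a value of some section `ξ f`; by continuity
the section stays in the open set over all nearby points. -/
lemma isOpenMap_proj_sectionTopology (hd : ∀ x, DenseRange fun f => ξ f x)
    (hξ : ∀ f, Continuous fun x => ‖ξ f x‖) :
    @IsOpenMap _ _ (sectionTopology ξ) _ (fun p : BundleSpace H => p.pt) := by
  let := sectionTopology ξ
  refine fun W hW => isOpen_iff_mem_nhds.2 ?_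
  rintro _ ⟨⟨x, u⟩, hu, rfl⟩
  have hx : Continuous fun a : H x => (⟨x, a⟩ : BundleSpace H) :=
    continuous_sectionTopology ξ continuous_const fun f =>
      show Continuous fun a : H x => ‖a - ξ f x‖ from (continuous_id.sub continuous_const).norm
  obtain ⟨f, hf⟩ := (hd x).exists_mem_open (hW.preimage hx) ⟨u, hu⟩
  have hs := continuous_section_sectionTopology hξ f
  filter_upwards [(hW.preimage hs).mem_nhds hf] with y hy
  exact ⟨_, hy, rfl⟩

/-- A vector is determined by its distances to a dense set. -/
lemma t2Space_sectionTopology [T2Space X] (hd : ∀ x, DenseRange fun f => ξ f x) :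
    @T2Space _ (sectionTopology ξ) := by
  let := sectionTopology ξ
  refine T2Space.of_injective_continuous
    (f := fun p : BundleSpace H => (p.pt, fun f => ‖p.vec - ξ f p.pt‖)) ?_ continuous_induced_dom
  rintro ⟨x, a⟩ ⟨y, b⟩ h
  obtain ⟨rfl, h⟩ := Prod.mk.inj h
  congr 1
  have h' : (fun w => ‖a - w‖) = fun w => ‖b - w‖ :=
    (hd x).equalizer (by fun_prop) (by fun_prop) h
  have := congrFun h' b
  rwa [sub_self, norm_zero, norm_sub_eq_zero_iff] at this

/-- The Hilbert bundle defined by a fibrewise dense space of sections with continuous norms. -/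
def HilbertBundle.ofSections [T2Space X] [∀ x, CompleteSpace (H x)] (ξ : V →ₗ[ℂ] ∀ x, H x)
    (hd : ∀ x, DenseRange fun f => ξ f x) (hξ : ∀ f, Continuous fun x => ‖ξ f x‖) :
    HilbertBundle.{u, w} X where
  fiber := H
  topology := sectionTopology ξ
  t2 := t2Space_sectionTopology hd
  continuous_proj := continuous_proj_sectionTopology ξ
  isOpenMap_proj := isOpenMap_proj_sectionTopology hd hξ
  continuous_norm := by simpa using continuous_dist_sectionTopology ξ 0
  continuous_add := by
    let := sectionTopology ξ
    let : TopologicalSpace (Σ x : X, H x × H x) := TopologicalSpace.induced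
      (fun q => ((⟨q.1, q.2.1⟩, ⟨q.1, q.2.2⟩) : BundleSpace H × BundleSpace H)) inferInstance
    have h : Continuous fun q : Σ x : X, H x × H x =>
        ((⟨q.1, q.2.1⟩, ⟨q.1, q.2.2⟩) : BundleSpace H × BundleSpace H) := continuous_induced_dom
    have h1 := continuous_fst.comp h
    have h2 := continuous_snd.comp h
    refine continuous_iff_continuousAt.2 fun ⟨x, a, b⟩ => tendsto_sectionTopology hξ
      ((continuous_proj_sectionTopology ξ).comp h1).continuousAt fun ε hε => ?_
    obtain ⟨f, hf⟩ := (hd x).exists_dist_lt a (half_pos hε)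
    obtain ⟨g, hg⟩ := (hd x).exists_dist_lt b (half_pos hε)
    rw [dist_eq_norm] at hf hg
    have key : ∀ (y : X) (c d : H y), ‖c - ξ f y‖ < ε / 2 → ‖d - ξ g y‖ < ε / 2 →
        ‖c + d - ξ (f + g) y‖ < ε := fun y c d hc hd => by
      rw [map_add, Pi.add_apply, add_sub_add_comm]
      exact (norm_add_le _ _).trans_lt (by linarith)
    refine ⟨f + g, key x a b hf hg, ?_⟩
    filter_upwards [((continuous_dist_sectionTopology ξ f).comp h1).continuousAt.eventually_lt
      continuousAt_const hf, ((continuous_dist_sectionTopology ξ g).comp h2).continuousAt.eventually_lt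
      continuousAt_const hg] with q hq1 hq2
    exact key _ _ _ hq1 hq2
  continuous_smul c := by
    let := sectionTopology ξ
    refine continuous_iff_continuousAt.2 fun ⟨x, a⟩ => tendsto_sectionTopology hξ
      (continuous_proj_sectionTopology ξ).continuousAt fun ε hε => ?_
    -- The summand `1` covers the case `c = 0`.
    have hδ : 0 < ε / (‖c‖ + 1) := by positivity
    obtain ⟨f, hf⟩ := (hd x).exists_dist_lt a hδ
    rw [dist_eq_norm] at hf
    have key : ∀ (y : X) (b : H y), ‖b - ξ f y‖ < ε / (‖c‖ + 1) →
        ‖c • b - ξ (c • f) y‖ < ε := fun y b hb => by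
      rw [map_smul, Pi.smul_apply, ← smul_sub, norm_smul]
      rw [lt_div_iff₀ (by positivity)] at hb
      nlinarith [norm_nonneg (b - ξ f y)]
    refine ⟨c • f, key x a hf, ?_⟩
    filter_upwards [(continuous_dist_sectionTopology ξ f).continuousAt.eventually_lt
      continuousAt_const hf] with q hq
    exact key _ _ hq
  le_nhds_zero x l hp hn := tendsto_sectionTopology (F := id) hξ hp fun ε hε =>
    ⟨0, by simpa using hε, by simpa using hn.eventually_lt_const hε⟩

end SectionTopology

/-! ### Uniqueness of the topology of a Hilbert bundle -/

section Uniqueness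

variable {X : Type u} [TopologicalSpace X] {V : Type*} [AddCommGroup V] [Module ℂ V]

/-- A Hilbert bundle carries the topology defined by any fibrewise dense space of sections the
distances to which are continuous. -/
lemma HilbertBundle.topology_eq_sectionTopology (E : HilbertBundle.{u, w} X)
    (ξ : V →ₗ[ℂ] ∀ x, E.fiber x) (hd : ∀ x, DenseRange fun f => ξ f x)
    (hN : ∀ f, Continuous fun p : BundleSpace E.fiber => ‖p.vec - ξ f p.pt‖) :
    E.topology = sectionTopology ξ := by
  refine le_antisymm (continuous_id_iff_le.1
    (continuous_sectionTopology ξ E.continuous_proj hN)) (le_of_nhds_le_nhds ?_)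
  rintro ⟨x, u⟩ W hW
  let ι := fun q : (Σ x : X, E.fiber x × E.fiber x) =>
    ((⟨q.1, q.2.1⟩, ⟨q.1, q.2.2⟩) : BundleSpace E.fiber × BundleSpace E.fiber)
  -- Continuity of addition at `(u, 0_x)` yields `W₁` and `W₀` whose fibrewise sum lies in `W`; the
  -- axiom on nets converging to zero then puts all vectors of norm below `δ` over points near `x`
  -- in `W₀`.
  have hadd := (@Continuous.tendsto _ _ (TopologicalSpace.induced ι inferInstance) _ _
    E.continuous_add ⟨x, u, 0⟩).eventually (p := (· ∈ W)) (by simpa using hW)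
  rw [nhds_induced, eventually_comap, nhds_prod_eq] at hadd
  obtain ⟨W₁, hW₁, W₀, hW₀, hadd⟩ := mem_prod_iff.1 hadd
  have hle := E.le_nhds_zero x (comap (fun p => p.pt) (𝓝 x) ⊓ comap (fun p => ‖p.vec‖) (𝓝 0))
    (tendsto_comap.mono_left inf_le_left) (tendsto_comap.mono_left inf_le_right) hW₀
  obtain ⟨A, ⟨A₁, hA₁, hA⟩, B, ⟨B₁, hB₁, hB⟩, hAB⟩ := mem_inf_iff_superset.1 hle
  obtain ⟨δ, hδ, hB₁⟩ := Metric.mem_nhds_iff.1 hB₁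
  obtain ⟨f, hf⟩ := (hd x).exists_dist_lt u (half_pos hδ)
  rw [dist_eq_norm] at hf
  have hW₂ : W₁ ∩ {p | ‖p.vec - ξ f p.pt‖ < δ / 2} ∈ 𝓝 (⟨x, u⟩ : BundleSpace E.fiber) :=
    inter_mem hW₁ ((hN f).continuousAt.eventually_lt continuousAt_const hf)
  -- Openness of the projection supplies, over every `y` near `x`, some `b ∈ W₁` within `δ / 2` of
  -- `ξ f y`. If `a` is also within `δ / 2` of it, then `a = b + (a - b)` with `a - b ∈ W₀`.
  have hW₃ := E.isOpenMap_proj.image_mem_nhds hW₂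
  let := sectionTopology ξ
  filter_upwards [(continuous_proj_sectionTopology ξ).continuousAt.preimage_mem_nhds
    (inter_mem hW₃ hA₁), (continuous_dist_sectionTopology ξ f).continuousAt.eventually_lt
      continuousAt_const hf]
  rintro ⟨y, a⟩ ⟨⟨⟨_, b⟩, ⟨hb₁, hb₂⟩, rfl⟩, hy⟩ ha
  have h0 : (⟨_, a - b⟩ : BundleSpace E.fiber) ∈ W₀ := hAB ⟨hA hy, hB (hB₁ (by
    simp only [Metric.mem_ball, dist_zero_right, norm_norm]
    rw [← sub_sub_sub_cancel_right a b (ξ f _)]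
    exact (norm_sub_le _ _).trans_lt ((add_lt_add ha hb₂).trans_eq (add_halves δ))))⟩
  simpa using hadd (Set.mk_mem_prod hb₁ h0) ⟨_, b, a - b⟩ rfl

end Uniqueness

/-! ### Integration along a Haar system -/

section Integration

variable {X : Type u} [Groupoid.{v} X]

lemma injective_toArr_unit : Function.Injective fun x : X => toArr (𝟙 x) :=
  fun _ _ h => congrArg Arr.source h

lemma injective_rangeFiber_toArr (x : X) :
    Function.Injective fun γ : RangeFiber x => toArr γ.hom := by
  intro ⟨y, γ⟩ ⟨z, γ'⟩ h
  simp only [toArr, Arr.mk.injEq, true_and] at h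
  simpa using h

variable [TopologicalSpace (Arr X)]

lemma continuous_rangeFiber_toArr (x : X) :
    Continuous fun γ : RangeFiber x => toArr γ.hom :=
  continuous_induced_dom

/-- The pairs `(t, γ)` with `γ ∈ G^{p t}`. -/
structure PullbackArr {T : Type*} (p : T → X) where
  /-- the parameter -/
  pt : T
  /-- the arrow with range `p pt` -/
  arr : RangeFiber (p pt)

/-- `PullbackArr p` carries the subspace topology of `T × G`. -/
instance {T : Type*} [TopologicalSpace T] (p : T → X) : TopologicalSpace (PullbackArr p) :=
  TopologicalSpace.induced (fun q => (q.pt, toArr q.arr.hom)) inferInstance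

section Pullback

variable {T : Type*} [TopologicalSpace T] {p : T → X}

lemma PullbackArr.continuous_coe :
    Continuous fun q : PullbackArr p => (q.pt, toArr q.arr.hom) :=
  continuous_induced_dom

lemma PullbackArr.continuous_pt : Continuous fun q : PullbackArr p => q.pt :=
  PullbackArr.continuous_coe.fst

lemma PullbackArr.continuous_arr : Continuous fun q : PullbackArr p => toArr q.arr.hom :=
  PullbackArr.continuous_coe.snd

lemma PullbackArr.continuous_mk (t : T) :
    Continuous fun γ : RangeFiber (p t) => (⟨t, γ⟩ : PullbackArr p) :=
  continuous_induced_rng.2 (continuous_const.prodMk (continuous_rangeFiber_toArr _))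

end Pullback

variable [TopologicalSpace X]

lemma HaarSystem.continuous_integral_norm (haar : HaarSystem X)
    (f : CompactlySupportedContinuousMap (Arr X) ℂ) :
    Continuous fun x => ∫ γ, ‖f (toArr γ.hom)‖ ∂haar.measure x := by
  have h := haar.continuous_integral (f.compLeft ⟨fun z => (‖z‖ : ℂ), by fun_prop⟩)
  simp only [CompactlySupportedContinuousMap.compLeft_apply, ContinuousMap.coe_mk, norm_zero,
    Complex.ofReal_zero, integral_complex_ofReal] at h
  exact Complex.continuous_re.comp h

lemma IsTopologicalGroupoid.t2Space [IsTopologicalGroupoid X] [T2Space (Arr X)] : T2Space X :=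
  T2Space.of_injective_continuous injective_toArr_unit IsTopologicalGroupoid.continuous_unit

lemma isClosedEmbedding_toArr [IsTopologicalGroupoid X] [T2Space (Arr X)] (x : X) :
    IsClosedEmbedding fun γ : RangeFiber x => toArr γ.hom := by
  have := IsTopologicalGroupoid.t2Space (X := X)
  refine ⟨⟨⟨rfl⟩, injective_rangeFiber_toArr x⟩, ?_⟩
  · convert isClosed_singleton.preimage
      (IsTopologicalGroupoid.continuous_range (X := X)) (t := {x}) using 1
    ext ⟨y, z, γ⟩
    constructor
    · rintro ⟨γ', h⟩
      exact (congrArg Arr.range h).symm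
    · rintro rfl
      exact ⟨⟨y, γ⟩, rfl⟩

variable [IsTopologicalGroupoid X] [T2Space (Arr X)]

lemma hasCompactSupport_rangeFiber (f : CompactlySupportedContinuousMap (Arr X) ℂ) (x : X) :
    HasCompactSupport fun γ : RangeFiber x => f (toArr γ.hom) :=
  f.hasCompactSupport.comp_isClosedEmbedding (isClosedEmbedding_toArr x)

lemma HaarSystem.integrable_smul (haar : HaarSystem X) {B : Type*} [NormedAddCommGroup B]
    [NormedSpace ℂ B] (f : CompactlySupportedContinuousMap (Arr X) ℂ) {x : X}
    {v : RangeFiber x → B} (hv : Continuous v) :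
    Integrable (fun γ => f (toArr γ.hom) • v γ) (haar.measure x) := by
  have := haar.regular x
  exact ((f.continuous.comp (continuous_rangeFiber_toArr x)).smul hv).integrable_of_hasCompactSupport
    (hasCompactSupport_rangeFiber f x).smul_right

lemma HaarSystem.integrable_norm (haar : HaarSystem X)
    (f : CompactlySupportedContinuousMap (Arr X) ℂ) (x : X) :
    Integrable (fun γ => ‖f (toArr γ.hom)‖) (haar.measure x) := by
  simpa using (haar.integrable_smul f (continuous_const (y := (1 : ℂ)))).norm

/-- Integrals along a Haar system of functions depending continuously on a parameter are
continuous. -/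
theorem HaarSystem.continuous_integral_mul [NormalSpace (Arr X)] (haar : HaarSystem X) {T : Type*}
    [TopologicalSpace T] {p : T → X} (hp : Continuous p)
    (f : CompactlySupportedContinuousMap (Arr X) ℂ) {F : ∀ t, RangeFiber (p t) → ℂ}
    (hF : Continuous fun q : PullbackArr p => F q.pt q.arr) :
    Continuous fun t => ∫ γ, f (toArr γ.hom) * F t γ ∂haar.measure (p t) := by
  have := IsTopologicalGroupoid.t2Space (X := X)
  have hFt : ∀ t, Continuous (F t) := fun t => hF.comp (PullbackArr.continuous_mk t)
  refine continuous_iff_continuousAt.2 fun t₀ => Metric.tendsto_nhds.2 fun ε hε => ?_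
  -- Tietze extension off the closed set `G^{p t₀}`: the integral at `t₀` becomes that of the fixed
  -- function `f * G` in `C_c(G)`, to which the continuity axiom of the Haar system applies.
  obtain ⟨G, hG⟩ := ContinuousMap.exists_extension (isClosedEmbedding_toArr (p t₀))
    ⟨F t₀, hFt t₀⟩
  replace hG : ∀ γ, G (toArr γ.hom) = F t₀ γ := fun γ => DFunLike.congr_fun hG γ
  let fG : CompactlySupportedContinuousMap (Arr X) ℂ :=
    ⟨f.toContinuousMap * G, f.hasCompactSupport.mul_right⟩
  have hfG : ∀ γ, fG γ = f γ * G γ := fun _ => rfl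
  -- Adding `1` makes `M` positive, and a bound for the mass of `‖f‖` at all `t` near `t₀`.
  set M := (∫ γ, ‖f (toArr γ.hom)‖ ∂haar.measure (p t₀)) + 1 with hM
  have hMpos : 0 < M := by positivity
  -- Compactness of the support of `f` makes the approximation of `F t` by `G` uniform.
  have hclose : ∀ᶠ t in 𝓝 t₀, ∀ γ ∈ tsupport f, ∀ γ' : RangeFiber (p t), toArr γ'.hom = γ →
      ‖F t γ' - G γ‖ < ε / (2 * M) := by
    refine f.hasCompactSupport.isCompact.eventually_forall_of_forall_eventually fun γ _ => ?_
    by_cases hγ : γ.range = p t₀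
    · obtain ⟨y, z, γ⟩ := γ
      obtain rfl : z = p t₀ := hγ
      have hc : Continuous fun q : PullbackArr p => ‖F q.pt q.arr - G (toArr q.arr.hom)‖ :=
        (hF.sub (G.continuous.comp PullbackArr.continuous_arr)).norm
      have := (hc.tendsto ⟨t₀, y, γ⟩).eventually_lt_const (u := ε / (2 * M))
        (by rw [hG, sub_self, norm_zero]; positivity)
      rw [nhds_induced, eventually_comap] at this
      filter_upwards [this]
      rintro ⟨t, γ₁⟩ h (γ₂ : RangeFiber (p t)) (rfl : toArr γ₂.hom = γ₁)
      exact h ⟨t, γ₂⟩ rfl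
    -- A point off `G^{p t₀}` has a neighbourhood that avoids `G^{p t}` for all `t` near `t₀`, so
    -- nothing has to be estimated there.
    · have hne := ((IsTopologicalGroupoid.continuous_range.comp continuous_snd).prodMk
        (hp.comp continuous_fst)).continuousAt (x := (t₀, γ)) |>.preimage_mem_nhds
          (isClosed_diagonal.isOpen_compl.mem_nhds (x := (γ.range, p t₀)) hγ)
      filter_upwards [hne]
      rintro ⟨t, γ₁⟩ h (γ₂ : RangeFiber (p t)) (rfl : toArr γ₂.hom = γ₁)
      exact absurd rfl h
  filter_upwards [hclose,
    ((haar.continuous_integral_norm f).comp hp).continuousAt.eventually_lt continuousAt_const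
      (lt_add_one _), Metric.tendsto_nhds.1 (((haar.continuous_integral fG).comp hp).tendsto t₀)
      (ε / 2) (half_pos hε)] with t h1 h2 h3
  have h4 : ‖(∫ γ, f (toArr γ.hom) * F t γ ∂haar.measure (p t)) -
      ∫ γ, fG (toArr γ.hom) ∂haar.measure (p t)‖ ≤
        ∫ γ, ε / (2 * M) * ‖f (toArr γ.hom)‖ ∂haar.measure (p t) := by
    simp only [hfG, ← smul_eq_mul (f _)]
    rw [← integral_sub (haar.integrable_smul f (hFt t))
      (haar.integrable_smul f (v := fun γ => G (toArr γ.hom))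
        (G.continuous.comp (continuous_rangeFiber_toArr _)))]
    refine norm_integral_le_of_norm_le ((haar.integrable_norm f _).const_mul _)
      (ae_of_all _ fun γ => ?_)
    rw [← smul_sub, norm_smul, mul_comm]
    by_cases hγ : toArr γ.hom ∈ tsupport f
    · exact mul_le_mul_of_nonneg_right (h1 _ hγ γ rfl).le (norm_nonneg _)
    · simp [image_eq_zero_of_notMem_tsupport hγ]
  rw [integral_const_mul] at h4
  have h5 : ε / (2 * M) * (∫ γ, ‖f (toArr γ.hom)‖ ∂haar.measure (p t)) < ε / 2 := by
    calc _ < ε / (2 * M) * M := mul_lt_mul_of_pos_left h2 (by positivity)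
      _ = ε / 2 := by field_simp
  have h6 : (∫ γ, f (toArr γ.hom) * F t₀ γ ∂haar.measure (p t₀)) =
      ∫ γ, fG (toArr γ.hom) ∂haar.measure (p t₀) := by
    simp only [hfG, hG]
  rw [h6]
  calc _ ≤ _ := dist_triangle _ _ _
    _ < ε / 2 + ε / 2 := add_lt_add ((dist_eq_norm _ _).trans_lt (h4.trans_lt h5)) h3
    _ = ε := add_halves ε

/-- Approximate units of `C_c(G)` concentrated near a point of `G^x`. -/
lemma HaarSystem.exists_bump [LocallyCompactSpace (Arr X)] (haar : HaarSystem X) {x : X}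
    (γ₀ : RangeFiber x) {U : Set (RangeFiber x)} (hU : U ∈ 𝓝 γ₀) :
    ∃ f : CompactlySupportedContinuousMap (Arr X) ℂ,
      (∀ γ : RangeFiber x, f (toArr γ.hom) ≠ 0 → γ ∈ U) ∧
      ∫ γ, f (toArr γ.hom) ∂haar.measure x = 1 ∧
      ∫ γ, ‖f (toArr γ.hom)‖ ∂haar.measure x = 1 := by
  have := haar.regular x
  have := haar.full_support x
  rw [(isClosedEmbedding_toArr x).nhds_eq_comap] at hU
  obtain ⟨W, hW, hWU⟩ := hU
  obtain ⟨g, h1, h0, hg, hI⟩ := exists_continuous_one_zero_of_isCompact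
    (isCompact_singleton (x := toArr γ₀.hom)) (isOpen_interior (s := W)).isClosed_compl
    (Set.disjoint_singleton_left.2 fun h => h (mem_interior_iff_mem_nhds.2 hW))
  let g' : CompactlySupportedContinuousMap (Arr X) ℂ := ⟨⟨fun γ => (g γ : ℂ), by fun_prop⟩,
    hg.comp_left (g := fun r : ℝ => (r : ℂ)) Complex.ofReal_zero⟩
  have hg' : ∀ γ, g' γ = (g γ : ℂ) := fun _ => rfl
  set m := ∫ γ, g (toArr γ.hom) ∂haar.measure x with hm
  -- Full support of `λ^x` enters here, and allows the bump to be normalised.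
  have hpos : 0 < m := by
    refine (g.continuous.comp (continuous_rangeFiber_toArr x)).integral_pos_of_hasCompactSupport_nonneg_nonzero
      (hg.comp_isClosedEmbedding (isClosedEmbedding_toArr x)) (fun γ => (hI _).1) (x := γ₀) ?_
    simp [h1 rfl]
  refine ⟨((m⁻¹ : ℝ) : ℂ) • g', fun γ hγ => ?_, ?_, ?_⟩
  · by_contra h
    refine hγ ?_
    rw [CompactlySupportedContinuousMap.smul_apply, hg',
      h0 fun h' => h (hWU (interior_subset (s := W) h'))]
    simp
  · simp only [CompactlySupportedContinuousMap.smul_apply, hg', smul_eq_mul]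
    rw [integral_const_mul, integral_complex_ofReal, ← hm, ← Complex.ofReal_mul, inv_mul_cancel₀ hpos.ne',
      Complex.ofReal_one]
  · have : ∀ γ : RangeFiber x, ‖(((m⁻¹ : ℝ) : ℂ) • g') (toArr γ.hom)‖ = m⁻¹ * g (toArr γ.hom) := by
      intro γ
      rw [CompactlySupportedContinuousMap.smul_apply, hg', smul_eq_mul, ← Complex.ofReal_mul,
        Complex.norm_real, Real.norm_of_nonneg (mul_nonneg (inv_nonneg.2 hpos.le) (hI _).1)]
    simp only [this]
    rw [integral_const_mul, ← hm, inv_mul_cancel₀ hpos.ne']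

/-- Since `f` has mass `1`, `b` is its own average, so the difference is an average of `v - b`. -/
lemma HaarSystem.norm_integral_smul_sub_le (haar : HaarSystem X) {B : Type*}
    [NormedAddCommGroup B] [NormedSpace ℂ B] [CompleteSpace B] {x : X}
    {f : CompactlySupportedContinuousMap (Arr X) ℂ}
    (hf : ∫ γ, f (toArr γ.hom) ∂haar.measure x = 1)
    (hf' : ∫ γ, ‖f (toArr γ.hom)‖ ∂haar.measure x = 1) {v : RangeFiber x → B} (hv : Continuous v)
    {b : B} {ε : ℝ} (h : ∀ γ : RangeFiber x, f (toArr γ.hom) ≠ 0 → ‖v γ - b‖ ≤ ε) :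
    ‖(∫ γ, f (toArr γ.hom) • v γ ∂haar.measure x) - b‖ ≤ ε := by
  have h1 : b = ∫ γ, f (toArr γ.hom) • b ∂haar.measure x := by
    rw [integral_smul_const, hf, one_smul]
  conv_lhs => rw [h1]
  rw [← integral_sub (haar.integrable_smul f hv) (haar.integrable_smul f continuous_const)]
  calc _ ≤ ∫ γ, ε * ‖f (toArr γ.hom)‖ ∂haar.measure x := by
        refine norm_integral_le_of_norm_le ((haar.integrable_norm f x).const_mul _)
          (ae_of_all _ fun γ => ?_)
        rw [← smul_sub, norm_smul, mul_comm]
        by_cases hγ : f (toArr γ.hom) = 0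
        · simp [hγ]
        · exact mul_le_mul_of_nonneg_right (h γ hγ) (norm_nonneg _)
    _ = ε := by rw [integral_const_mul, hf', mul_one]

end Integration

/-! ### Continuity of products, and of functions defined by inner products -/

section Continuity

lemma continuous_of_continuous_inner {Y H : Type*} [TopologicalSpace Y] [NormedAddCommGroup H]
    [InnerProductSpace ℂ H] {a : Y → H}
    (h : Continuous fun p : Y × Y => (inner ℂ (a p.1) (a p.2) : ℂ)) : Continuous a := by
  refine continuous_iff_continuousAt.2 fun y₀ => tendsto_iff_norm_sub_tendsto_zero.2 ?_
  have h1 : Continuous fun y => ‖a y - a y₀‖ ^ 2 := by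
    simp only [@norm_sub_sq ℂ, @norm_sq_eq_re_inner ℂ]
    have hre := Complex.continuous_re
    have h2 := hre.comp (h.comp (continuous_id.prodMk continuous_id))
    have h3 := hre.comp (h.comp (continuous_id.prodMk (continuous_const (y := y₀))))
    exact (h2.sub (continuous_const.mul h3)).add continuous_const
  have h2 := (h1.sqrt).tendsto y₀
  simpa using h2

/-- The fibre varies with `t`, so continuity can only be stated for scalars; expanding the square
reduces it to norms and inner products. -/
lemma continuous_norm_sub {T : Type*} [TopologicalSpace T] {H : T → Type*}
    [∀ t, NormedAddCommGroup (H t)] [∀ t, InnerProductSpace ℂ (H t)] {a b : ∀ t, H t}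
    (ha : Continuous fun t => ‖a t‖) (hb : Continuous fun t => ‖b t‖)
    (hab : Continuous fun t => (inner ℂ (a t) (b t) : ℂ)) :
    Continuous fun t => ‖a t - b t‖ := by
  have h1 : Continuous fun t => ‖a t - b t‖ ^ 2 := by
    simp only [@norm_sub_sq ℂ]
    exact ((ha.pow 2).sub (continuous_const.mul (Complex.continuous_re.comp hab))).add (hb.pow 2)
  simpa using h1.sqrt

variable {X : Type u} [TopologicalSpace X] [Groupoid.{v} X] [TopologicalSpace (Arr X)]
  [IsTopologicalGroupoid X] {T : Type*} [TopologicalSpace T] {x y z : T → X}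

lemma Continuous.toArr_comp {γ : ∀ t, x t ⟶ y t} {γ' : ∀ t, y t ⟶ z t}
    (h : Continuous fun t => toArr (γ t)) (h' : Continuous fun t => toArr (γ' t)) :
    Continuous fun t => toArr (γ t ≫ γ' t) :=
  (IsTopologicalGroupoid.continuous_mul (X := X)).comp
    (g := fun p : ComposablePair X => toArr (p.snd ≫ p.fst))
    (f := fun t => ⟨x t, y t, z t, γ' t, γ t⟩) (continuous_induced_rng.2 (h'.prodMk h))

lemma Continuous.toArr_inv {γ : ∀ t, x t ⟶ y t} (h : Continuous fun t => toArr (γ t)) :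
    Continuous fun t => toArr (Groupoid.inv (γ t)) :=
  (IsTopologicalGroupoid.continuous_inv (X := X)).comp h

lemma continuous_invMul (x : X) :
    Continuous fun p : RangeFiber x × RangeFiber x => invMul p.1 p.2 :=
  ((continuous_rangeFiber_toArr x).comp continuous_snd).toArr_comp
    ((continuous_rangeFiber_toArr x).comp continuous_fst).toArr_inv

lemma continuous_of_inner_eq {φ : Arr X → ℂ} (hφ : Continuous φ) {x : X} {H : Type*}
    [NormedAddCommGroup H] [InnerProductSpace ℂ H] {a : RangeFiber x → H}
    (hin : ∀ γ γ', inner ℂ (a γ) (a γ') = φ (invMul γ γ')) : Continuous a := by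
  refine continuous_of_continuous_inner ?_
  simp only [hin]
  exact hφ.comp (continuous_invMul x)

end Continuity

/-! ### The sections `x ↦ ∫ f(γ) v(γ) dλ^x(γ)` -/

section CoeffSection

variable {X : Type u} [TopologicalSpace X] [Groupoid.{v} X] [TopologicalSpace (Arr X)]
  [IsTopologicalGroupoid X] [T2Space (Arr X)] (haar : HaarSystem X)
  {H : X → Type w} [∀ x, NormedAddCommGroup (H x)] [∀ x, InnerProductSpace ℂ (H x)]
  {a : ∀ x, RangeFiber x → H x}

/-- The sections `x ↦ ∫ f(γ) a(γ) dλ^x(γ)`, for `f ∈ C_c(G)`. -/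
noncomputable def HaarSystem.integralSection (ha : ∀ x, Continuous (a x)) :
    CompactlySupportedContinuousMap (Arr X) ℂ →ₗ[ℂ] ∀ x, H x where
  toFun f x := ∫ γ, f (toArr γ.hom) • a x γ ∂haar.measure x
  map_add' f g := by
    funext x
    simp only [CompactlySupportedContinuousMap.add_apply, add_smul, Pi.add_apply]
    exact integral_add (haar.integrable_smul f (ha x)) (haar.integrable_smul g (ha x))
  map_smul' c f := by
    funext x
    simp only [CompactlySupportedContinuousMap.smul_apply, smul_assoc, Pi.smul_apply,
      RingHom.id_apply]
    exact integral_smul _ _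

variable {haar} {φ : Arr X → ℂ}

/-- Bumps concentrated near `γ₀` give integrals close to `a x γ₀`, so the closure of the range
contains a total family. -/
lemma HaarSystem.denseRange_integralSection [LocallyCompactSpace (Arr X)]
    [∀ x, CompleteSpace (H x)] (ha : ∀ x, Continuous (a x)) (x : X)
    (hd : Dense (Submodule.span ℂ (Set.range (a x)) : Set (H x))) :
    DenseRange fun f => haar.integralSection ha f x := by
  let R := LinearMap.range ((LinearMap.proj x).comp (haar.integralSection ha))
  have hle : Submodule.span ℂ (Set.range (a x)) ≤ R.topologicalClosure := by
    rw [Submodule.span_le]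
    rintro _ ⟨γ₀, rfl⟩
    refine Metric.mem_closure_iff.2 fun ε hε => ?_
    obtain ⟨f, hf, hf1, hf2⟩ := haar.exists_bump γ₀
      ((ha x).continuousAt.preimage_mem_nhds (Metric.ball_mem_nhds (a x γ₀) (half_pos hε)))
    refine ⟨_, ⟨f, rfl⟩, ?_⟩
    rw [dist_comm, dist_eq_norm]
    refine (haar.norm_integral_smul_sub_le hf1 hf2 (ha x) (ε := ε / 2) fun γ hγ => ?_).trans_lt
      (half_lt_self hε)
    rw [← dist_eq_norm]
    exact (hf γ hγ).le
  have h1 : Dense (R.topologicalClosure : Set (H x)) := hd.mono hle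
  have h2 : Dense (R : Set (H x)) := by
    rw [Submodule.topologicalClosure_coe, dense_iff_closure_eq, closure_closure] at h1
    exact dense_iff_closure_eq.2 h1
  exact h2

lemma HaarSystem.inner_integralSection [∀ x, CompleteSpace (H x)] (ha : ∀ x, Continuous (a x))
    (f : CompactlySupportedContinuousMap (Arr X) ℂ) (x : X) (b : H x) :
    inner ℂ b (haar.integralSection ha f x) =
      ∫ γ, f (toArr γ.hom) * inner ℂ b (a x γ) ∂haar.measure x := by
  refine (integral_inner (haar.integrable_smul f (ha x)) b).symm.trans ?_
  simp only [inner_smul_right]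

variable (haar φ) in
/-- The double integral `∫∫ conj f(γ₁) g(γ₂) conj φ(γ₂⁻¹ γ γ₁) dλ^{s(γ)}(γ₁) dλ^{r(γ)}(γ₂)`. -/
noncomputable def HaarSystem.pairing (f g : CompactlySupportedContinuousMap (Arr X) ℂ)
    (γ : Arr X) : ℂ :=
  ∫ γ₂ : RangeFiber γ.range, g (toArr γ₂.hom) * (starRingEnd ℂ)
    (∫ γ₁ : RangeFiber γ.source, f (toArr γ₁.hom) *
      φ (toArr (γ₁.hom ≫ γ.hom ≫ Groupoid.inv γ₂.hom)) ∂haar.measure γ.source)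
    ∂haar.measure γ.range

/-- Continuity of parameter integrals is used twice; in the inner integral the parameter is the pair
`(γ, γ₂)`. -/
lemma HaarSystem.continuous_pairing [NormalSpace (Arr X)] (hφ : Continuous φ)
    (f g : CompactlySupportedContinuousMap (Arr X) ℂ) : Continuous (haar.pairing φ f g) := by
  refine haar.continuous_integral_mul IsTopologicalGroupoid.continuous_range g ?_
  refine Complex.continuous_conj.comp ?_
  refine haar.continuous_integral_mul (p := fun q : PullbackArr (Arr.range (X := X)) => q.pt.source)
    (IsTopologicalGroupoid.continuous_source.comp PullbackArr.continuous_pt) f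
    (F := fun q γ₁ => φ (toArr (γ₁.hom ≫ q.pt.hom ≫ Groupoid.inv q.arr.hom))) ?_
  refine hφ.comp (PullbackArr.continuous_arr.toArr_comp (Continuous.toArr_comp ?_ ?_))
  · exact PullbackArr.continuous_pt.comp PullbackArr.continuous_pt
  · exact (PullbackArr.continuous_arr.comp PullbackArr.continuous_pt).toArr_inv

/-- Inner products of translates of the sections `haar.integralSection`. -/
lemma HaarSystem.inner_map_integralSection [∀ x, CompleteSpace (H x)]
    (ha : ∀ x, Continuous (a x))
    (hin : ∀ x (γ γ' : RangeFiber x), inner ℂ (a x γ) (a x γ') = φ (invMul γ γ'))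
    (f g : CompactlySupportedContinuousMap (Arr X) ℂ) {x y : X} (γ : x ⟶ y)
    (S : H x →ₗᵢ[ℂ] H y) (hS : ∀ γ' : RangeFiber x, S (a x γ') = a y ⟨γ'.source, γ'.hom ≫ γ⟩) :
    inner ℂ (S (haar.integralSection ha f x)) (haar.integralSection ha g y) =
      haar.pairing φ f g (toArr γ) := by
  rw [haar.inner_integralSection]
  refine integral_congr_ae (ae_of_all _ fun γ₂ => ?_)
  have h : S (haar.integralSection ha f x) =
      ∫ γ', f (toArr γ'.hom) • S (a x γ') ∂haar.measure x := by
    refine (S.toContinuousLinearMap.integral_comp_comm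
      (haar.integrable_smul f (ha x))).symm.trans ?_
    simp
  have hint : Integrable (fun γ' => f (toArr γ'.hom) • S (a x γ')) (haar.measure x) :=
    haar.integrable_smul f (S.continuous.comp (ha x))
  dsimp only
  rw [← inner_conj_symm, h, ← integral_inner hint]
  simp only [inner_smul_right, hS, hin, invMul, Category.assoc]
  rfl

lemma HaarSystem.inner_integralSection_integralSection [∀ x, CompleteSpace (H x)]
    (ha : ∀ x, Continuous (a x))
    (hin : ∀ x (γ γ' : RangeFiber x), inner ℂ (a x γ) (a x γ') = φ (invMul γ γ'))
    (f g : CompactlySupportedContinuousMap (Arr X) ℂ) (x : X) :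
    inner ℂ (haar.integralSection ha f x) (haar.integralSection ha g x) =
      haar.pairing φ f g (toArr (𝟙 x)) :=
  haar.inner_map_integralSection ha hin f g (𝟙 x) LinearIsometry.id fun γ' => by
    simp

lemma HaarSystem.continuous_norm_integralSection [NormalSpace (Arr X)] [∀ x, CompleteSpace (H x)]
    (hφ : Continuous φ) (ha : ∀ x, Continuous (a x))
    (hin : ∀ x (γ γ' : RangeFiber x), inner ℂ (a x γ) (a x γ') = φ (invMul γ γ'))
    (f : CompactlySupportedContinuousMap (Arr X) ℂ) :
    Continuous fun x => ‖haar.integralSection ha f x‖ := by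
  simp only [@norm_eq_sqrt_re_inner ℂ, haar.inner_integralSection_integralSection ha hin]
  exact (Complex.continuous_re.comp ((haar.continuous_pairing hφ f f).comp
    IsTopologicalGroupoid.continuous_unit)).sqrt

/-- The parameter space `T` serves two purposes: `T = X` for the continuity of the canonical
section, and `T` a total space to identify the topology of a given bundle. -/
lemma HaarSystem.continuous_norm_sub_integralSection [NormalSpace (Arr X)]
    [∀ x, CompleteSpace (H x)] (hφ : Continuous φ) (ha : ∀ x, Continuous (a x))
    (hin : ∀ x (γ γ' : RangeFiber x), inner ℂ (a x γ) (a x γ') = φ (invMul γ γ'))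
    {T : Type*} [TopologicalSpace T] {p : T → X} (hp : Continuous p) {b : ∀ t, H (p t)}
    (hb : Continuous fun t => ‖b t‖)
    (hba : Continuous fun q : PullbackArr p => (inner ℂ (b q.pt) (a _ q.arr) : ℂ))
    (f : CompactlySupportedContinuousMap (Arr X) ℂ) :
    Continuous fun t => ‖b t - haar.integralSection ha f (p t)‖ := by
  refine continuous_norm_sub hb ((haar.continuous_norm_integralSection hφ ha hin f).comp hp) ?_
  simp only [haar.inner_integralSection]
  exact haar.continuous_integral_mul hp f (F := fun t γ => inner ℂ (b t) (a (p t) γ)) hba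

end CoeffSection

/-! ### The Hilbert spaces of a function of positive type -/

namespace IsPositiveType

variable {X : Type u} [Groupoid.{v} X] {φ : Arr X → ℂ}

/-- The Hilbert space of the kernel `(γ, γ') ↦ φ(γ⁻¹γ')` on `G^x`. -/
def space (h : IsPositiveType φ) (x : X) : Type (max u v) :=
  KernelSpace _ (h x)

noncomputable instance (h : IsPositiveType φ) (x : X) : NormedAddCommGroup (h.space x) :=
  inferInstanceAs (NormedAddCommGroup (KernelSpace _ (h x)))

noncomputable instance (h : IsPositiveType φ) (x : X) : InnerProductSpace ℂ (h.space x) :=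
  inferInstanceAs (InnerProductSpace ℂ (KernelSpace _ (h x)))

instance (h : IsPositiveType φ) (x : X) : CompleteSpace (h.space x) :=
  inferInstanceAs (CompleteSpace (KernelSpace _ (h x)))

/-- The vector of `h.space x` defined by `γ ∈ G^x`. -/
noncomputable def vec (h : IsPositiveType φ) (x : X) (γ : RangeFiber x) : h.space x :=
  kernelVec (h x) γ

lemma inner_vec (h : IsPositiveType φ) (x : X) (γ γ' : RangeFiber x) :
    inner ℂ (h.vec x γ) (h.vec x γ') = φ (invMul γ γ') :=
  inner_kernelVec (h x) γ γ'

lemma dense_span_vec (h : IsPositiveType φ) (x : X) :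
    Dense (Submodule.span ℂ (Set.range (h.vec x)) : Set (h.space x)) :=
  dense_span_kernelVec (h x)

lemma continuous_vec [TopologicalSpace X] [TopologicalSpace (Arr X)] [IsTopologicalGroupoid X]
    (h : IsPositiveType φ) (hφ : Continuous φ) (x : X) : Continuous (h.vec x) :=
  continuous_of_inner_eq hφ (h.inner_vec x)

end IsPositiveType

/-! ### Integral characterisation of positive type -/

section PositiveType

variable {X : Type u} [TopologicalSpace X] [Groupoid.{v} X] [TopologicalSpace (Arr X)]
  [IsTopologicalGroupoid X] [T2Space (Arr X)] (haar : HaarSystem X) {φ : Arr X → ℂ}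

/-- The double integral is the squared norm of the section of `f` at `x`. -/
lemma IsPositiveType.integral_nonneg (h : IsPositiveType φ) (hφ : Continuous φ)
    (f : CompactlySupportedContinuousMap (Arr X) ℂ) (x : X) :
    0 ≤ ∫ γ', ∫ γ, φ (invMul γ γ') * (starRingEnd ℂ) (f (toArr γ.hom)) * f (toArr γ'.hom)
      ∂(haar.measure x) ∂(haar.measure x) := by
  have ha := h.continuous_vec hφ
  suffices H : (∫ γ', ∫ γ, φ (invMul γ γ') * (starRingEnd ℂ) (f (toArr γ.hom)) * f (toArr γ'.hom)
      ∂(haar.measure x) ∂(haar.measure x)) =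
      inner ℂ (haar.integralSection ha f x) (haar.integralSection ha f x) by
    rw [H]
    exact Complex.nonneg_iff.2 ⟨inner_self_nonneg (𝕜 := ℂ), (inner_self_im (𝕜 := ℂ) _).symm⟩
  rw [haar.inner_integralSection]
  refine integral_congr_ae (ae_of_all _ fun γ' => ?_)
  dsimp only
  rw [integral_mul_const, ← inner_conj_symm, haar.inner_integralSection, ← integral_conj, mul_comm]
  congr 1
  refine integral_congr_ae (ae_of_all _ fun γ => ?_)
  dsimp only
  rw [map_mul, inner_conj_symm, h.inner_vec, mul_comm]

/-- For `f = ∑ c_i f_i`, with `f_i` an approximate Dirac mass at `y i`, the double integral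
approximates the quadratic form of the matrix at `c`. -/
lemma isPositiveType_of_integral_nonneg [LocallyCompactSpace (Arr X)] [NormalSpace (Arr X)]
    (hφ : Continuous φ)
    (h : ∀ (f : CompactlySupportedContinuousMap (Arr X) ℂ) (x : X),
      0 ≤ ∫ γ', ∫ γ, φ (invMul γ γ') * (starRingEnd ℂ) (f (toArr γ.hom)) * f (toArr γ'.hom)
        ∂(haar.measure x) ∂(haar.measure x)) : IsPositiveType φ := by
  intro x n y
  refine Matrix.posSemidef_of_dotProduct_mulVec_nonneg fun c => ?_
  set k : RangeFiber x → RangeFiber x → ℂ := fun γ γ' => φ (invMul γ γ') with hk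
  have hkc : Continuous fun p : RangeFiber x × RangeFiber x => k p.1 p.2 :=
    hφ.comp (continuous_invMul x)
  have hS : star c ⬝ᵥ (Matrix.of fun i j => k (y i) (y j)).mulVec c =
      ∑ j, ∑ i, c j * ((starRingEnd ℂ) (c i) * k (y i) (y j)) := by
    rw [Finset.sum_comm]
    simp only [dotProduct, Matrix.mulVec, Finset.mul_sum, Matrix.of_apply, Pi.star_apply,
      RCLike.star_def]
    exact Finset.sum_congr rfl fun i _ => Finset.sum_congr rfl fun j _ => by ring
  rw [hS]
  -- The nonnegative numbers are closed in `ℂ`, so a nonnegative number within every `ε` of the form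
  -- suffices.
  refine (isClosed_Ici (a := (0 : ℂ))).closure_subset (Metric.mem_closure_iff.2 fun ε hε => ?_)
  set C := ∑ j, ∑ i, ‖c j‖ * ‖c i‖ with hC
  have hC0 : 0 ≤ C := by positivity
  set δ := ε / (C + 1) with hδ
  have hδ0 : 0 < δ := by positivity
  have hnear : ∀ i j, ∃ A ∈ 𝓝 (y i), ∃ B ∈ 𝓝 (y j), ∀ γ ∈ A, ∀ γ' ∈ B,
      ‖k γ γ' - k (y i) (y j)‖ ≤ δ := by
    intro i j
    have := (hkc.tendsto (y i, y j)).eventually (Metric.closedBall_mem_nhds _ hδ0)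
    rw [nhds_prod_eq] at this
    obtain ⟨A, hA, B, hB, hAB⟩ := mem_prod_iff.1 this
    exact ⟨A, hA, B, hB, fun γ hγ γ' hγ' => by
      simpa [dist_eq_norm] using hAB (Set.mk_mem_prod hγ hγ')⟩
  choose A hA B hB hAB using hnear
  -- The bump at `y i` serves both as first and as second variable, hence must lie in the
  -- neighbourhoods `A i j` and `B j i` for all `j`.
  choose f hf hf1 hf2 using fun i => haar.exists_bump (y i)
    (inter_mem (iInter_mem.2 fun j => hA i j) (iInter_mem.2 fun j => hB j i))
  have hfA : ∀ i j (γ : RangeFiber x), f i (toArr γ.hom) ≠ 0 → γ ∈ A i j :=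
    fun i j γ hγ => Set.mem_iInter.1 (hf i γ hγ).1 j
  have hfB : ∀ i j (γ : RangeFiber x), f j (toArr γ.hom) ≠ 0 → γ ∈ B i j :=
    fun i j γ hγ => Set.mem_iInter.1 (hf j γ hγ).2 i
  have hs : ∀ i γ, (star (f i)) γ = (starRingEnd ℂ) (f i γ) := fun _ _ => rfl
  have hs1 : ∀ i, ∫ γ, (star (f i)) (toArr γ.hom) ∂haar.measure x = 1 := fun i => by
    simp only [hs, integral_conj, hf1, map_one]
  have hs2 : ∀ i, ∫ γ, ‖(star (f i)) (toArr γ.hom)‖ ∂haar.measure x = 1 := fun i => by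
    simp only [hs, RCLike.norm_conj, hf2]
  set J : Fin n → RangeFiber x → ℂ := fun i γ' =>
    ∫ γ, (star (f i)) (toArr γ.hom) * k γ γ' ∂haar.measure x with hJ
  have hkl : ∀ γ', Continuous fun γ => k γ γ' := fun γ' =>
    hkc.comp (continuous_id.prodMk continuous_const)
  have hJc : ∀ i, Continuous (J i) := by
    intro i
    refine haar.continuous_integral_mul (p := fun _ : RangeFiber x => x) continuous_const _
      (F := fun γ' γ => k γ γ') (hφ.comp ?_)
    exact ((continuous_rangeFiber_toArr x).comp PullbackArr.continuous_pt).toArr_comp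
      PullbackArr.continuous_arr.toArr_inv
  have hJk : ∀ i j, ‖(∫ γ', f j (toArr γ'.hom) * J i γ' ∂haar.measure x) - k (y i) (y j)‖ ≤ δ :=
    fun i j => haar.norm_integral_smul_sub_le (hf1 j) (hf2 j) (hJc i) fun γ' hγ' =>
      haar.norm_integral_smul_sub_le (hs1 i) (hs2 i) (hkl γ') fun γ hγ =>
        hAB i j γ (hfA i j γ (by simpa [hs] using hγ)) γ' (hfB i j γ' hγ')
  have hint : (∫ γ', ∫ γ, φ (invMul γ γ') * (starRingEnd ℂ) ((∑ i, c i • f i) (toArr γ.hom)) *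
      (∑ i, c i • f i) (toArr γ'.hom) ∂haar.measure x ∂haar.measure x) =
      ∑ j, ∑ i, c j * ((starRingEnd ℂ) (c i) *
        ∫ γ', f j (toArr γ'.hom) * J i γ' ∂haar.measure x) := by
    have h1 : ∀ γ', (∫ γ, φ (invMul γ γ') * (starRingEnd ℂ) ((∑ i, c i • f i) (toArr γ.hom)) *
        (∑ i, c i • f i) (toArr γ'.hom) ∂haar.measure x) =
        ∑ j, ∑ i, c j * ((starRingEnd ℂ) (c i) * (f j (toArr γ'.hom) * J i γ')) := by
      intro γ'
      have h2 : (∫ γ, φ (invMul γ γ') * (starRingEnd ℂ) ((∑ i, c i • f i) (toArr γ.hom))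
          ∂haar.measure x) = ∑ i, (starRingEnd ℂ) (c i) * J i γ' := by
        simp only [hJ, ← integral_const_mul]
        have hI : ∀ i, Integrable (fun γ : RangeFiber x => (starRingEnd ℂ) (c i) *
            ((star (f i)) (toArr γ.hom) * k γ γ')) (haar.measure x) := fun i =>
          (haar.integrable_smul (star (f i)) (hkl γ')).const_mul _
        rw [← integral_finsetSum _ fun i _ => hI i]
        refine integral_congr_ae (ae_of_all _ fun γ => ?_)
        simp only [CompactlySupportedContinuousMap.sum_apply,
          CompactlySupportedContinuousMap.smul_apply, map_sum, smul_eq_mul, map_mul,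
          Finset.mul_sum, hs]
        exact Finset.sum_congr rfl fun i _ => by rw [hk]; ring
      rw [integral_mul_const, h2, Finset.sum_comm, Finset.sum_mul]
      simp only [CompactlySupportedContinuousMap.sum_apply,
        CompactlySupportedContinuousMap.smul_apply, smul_eq_mul, Finset.mul_sum]
      exact Finset.sum_congr rfl fun i _ => Finset.sum_congr rfl fun j _ => by ring
    simp only [h1]
    have hI : ∀ j i, Integrable (fun γ' => c j * ((starRingEnd ℂ) (c i) *
        (f j (toArr γ'.hom) * J i γ'))) (haar.measure x) := fun j i =>
      ((haar.integrable_smul (f j) (hJc i)).const_mul _).const_mul _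
    rw [integral_finsetSum _ fun j _ => integrable_finsetSum _ fun i _ => hI j i]
    refine Finset.sum_congr rfl fun j _ => ?_
    rw [integral_finsetSum _ fun i _ => hI j i]
    exact Finset.sum_congr rfl fun i _ => by rw [integral_const_mul, integral_const_mul]
  refine ⟨_, h (∑ i, c i • f i) x, ?_⟩
  rw [dist_comm, hint, dist_eq_norm, ← Finset.sum_sub_distrib]
  calc _ ≤ ∑ j, ∑ i, ‖c j‖ * ‖c i‖ * δ := by
        refine norm_sum_le_of_le _ fun j _ => ?_
        rw [← Finset.sum_sub_distrib]
        refine norm_sum_le_of_le _ fun i _ => ?_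
        rw [← mul_sub, ← mul_sub, norm_mul, norm_mul, RCLike.norm_conj, mul_assoc]
        gcongr
        exact hJk i j
    _ = C * δ := by simp only [hC, Finset.sum_mul]
    _ < ε := by
        rw [hδ, mul_div_assoc', div_lt_iff₀ (by positivity)]
        nlinarith

end PositiveType

/-! ### The `G`-Hilbert bundle of a function of positive type -/

namespace IsPositiveType

/-! ### Left translations as isometries -/

section Translation

variable {X : Type u} [Groupoid.{v} X] {φ : Arr X → ℂ} (h : IsPositiveType φ)

/-- Left translation `G^x → G^y` by `γ : x ⟶ y`. -/
def _root_.RangeFiber.translate {x y : X} (γ : x ⟶ y) (γ' : RangeFiber x) : RangeFiber y :=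
  ⟨γ'.source, γ'.hom ≫ γ⟩

lemma _root_.RangeFiber.translate_surjective {x y : X} (γ : x ⟶ y) :
    Function.Surjective (RangeFiber.translate γ) :=
  fun γ' => ⟨⟨γ'.source, γ'.hom ≫ Groupoid.inv γ⟩, by simp [RangeFiber.translate]⟩

lemma _root_.invMul_translate {x y : X} (γ : x ⟶ y) (γ₁ γ₂ : RangeFiber x) :
    invMul (γ₁.translate γ) (γ₂.translate γ) = invMul γ₁ γ₂ := by
  simp [invMul, RangeFiber.translate]

/-- Translation by `γ` is onto `G^y` and leaves `γ₁⁻¹γ₂` unchanged, so both families are total with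
the same Gram kernel. -/
lemma exists_translation {x y : X} (γ : x ⟶ y) :
    ∃ U : h.space x ≃ₗᵢ[ℂ] h.space y, ∀ γ', U (h.vec x γ') = h.vec y (γ'.translate γ) := by
  refine exists_linearIsometryEquiv (h.dense_span_vec x) ?_ fun γ₁ γ₂ => ?_
  · have := (RangeFiber.translate_surjective γ).range_comp (h.vec y)
    rw [Function.comp_def] at this
    rw [this]
    exact h.dense_span_vec y
  · simp only [inner_vec, invMul_translate]

/-- The isometry `h.space x → h.space y` defined by left translation. -/
noncomputable def translation {x y : X} (γ : x ⟶ y) : h.space x →ₗᵢ[ℂ] h.space y :=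
  (h.exists_translation γ).choose.toLinearIsometry

lemma translation_vec {x y : X} (γ : x ⟶ y) (γ' : RangeFiber x) :
    h.translation γ (h.vec x γ') = h.vec y (γ'.translate γ) :=
  (h.exists_translation γ).choose_spec γ'

lemma translation_id (x : X) (u : h.space x) : h.translation (𝟙 x) u = u :=
  LinearIsometry.eq_of_dense_span (T := LinearIsometry.id) (h.dense_span_vec x)
    (fun γ => by simp [translation_vec, RangeFiber.translate]) u

lemma translation_comp {x y z : X} (γ : y ⟶ z) (γ' : x ⟶ y) (u : h.space x) :
    h.translation (γ' ≫ γ) u = h.translation γ (h.translation γ' u) :=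
  LinearIsometry.eq_of_dense_span (T := (h.translation γ).comp (h.translation γ'))
    (h.dense_span_vec x) (fun γ₁ => by simp [translation_vec, RangeFiber.translate]) u

end Translation

variable {X : Type u} [TopologicalSpace X] [Groupoid.{v} X] [TopologicalSpace (Arr X)]
  [IsTopologicalGroupoid X] [T2Space (Arr X)] (haar : HaarSystem X) {φ : Arr X → ℂ} (h : IsPositiveType φ)
  (hφ : Continuous φ)

/-- The continuous sections that define the topology of the bundle of `φ`. -/
noncomputable def sections : CompactlySupportedContinuousMap (Arr X) ℂ →ₗ[ℂ] ∀ x, h.space x :=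
  haar.integralSection (h.continuous_vec hφ)

lemma denseRange_sections [LocallyCompactSpace (Arr X)] (x : X) : DenseRange fun f => h.sections haar hφ f x :=
  haar.denseRange_integralSection _ x (h.dense_span_vec x)

variable [NormalSpace (Arr X)]

lemma continuous_norm_sections (f : CompactlySupportedContinuousMap (Arr X) ℂ) :
    Continuous fun x => ‖h.sections haar hφ f x‖ :=
  haar.continuous_norm_integralSection hφ _ h.inner_vec f

/-- The cross term of the squared norm is the continuous function `haar.pairing φ f g`. -/
lemma continuous_norm_translation_sub_sections
    (f g : CompactlySupportedContinuousMap (Arr X) ℂ) :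
    Continuous fun γ : Arr X => ‖h.translation γ.hom (h.sections haar hφ f γ.source) -
      h.sections haar hφ g γ.range‖ := by
  refine continuous_norm_sub (H := fun γ : Arr X => h.space γ.range) ?_
    ((h.continuous_norm_sections haar hφ g).comp IsTopologicalGroupoid.continuous_range) ?_
  · simp only [LinearIsometry.norm_map]
    exact (h.continuous_norm_sections haar hφ f).comp IsTopologicalGroupoid.continuous_source
  · refine (haar.continuous_pairing hφ f g).congr fun γ => ?_
    exact (haar.inner_map_integralSection _ h.inner_vec f g γ.hom _ (h.translation_vec γ.hom)).symm

variable [LocallyCompactSpace (Arr X)]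

/-- Approximate `u` by a section `f`, and the translate of `f` at `γ` by a section `g`. Both
estimates persist nearby, and the translations being isometric, they add up. -/
lemma continuous_translation :
    Continuous[TopologicalSpace.induced (fun q : (Σ γ : Arr X, h.space γ.source) =>
        ((q.1, ⟨q.1.source, q.2⟩) : Arr X × BundleSpace h.space))
          (@instTopologicalSpaceProd _ _ _ (sectionTopology (h.sections haar hφ))),
      sectionTopology (h.sections haar hφ)]
      (fun q : (Σ γ : Arr X, h.space γ.source) =>
        (⟨q.1.range, h.translation q.1.hom q.2⟩ : BundleSpace h.space)) := by
  let := sectionTopology (h.sections haar hφ)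
  let : TopologicalSpace (Σ γ : Arr X, h.space γ.source) := TopologicalSpace.induced
    (fun q => ((q.1, ⟨q.1.source, q.2⟩) : Arr X × BundleSpace h.space)) inferInstance
  have hq : Continuous fun q : Σ γ : Arr X, h.space γ.source =>
      ((q.1, ⟨q.1.source, q.2⟩) : Arr X × BundleSpace h.space) := continuous_induced_dom
  refine continuous_iff_continuousAt.2 fun ⟨γ, u⟩ =>
    tendsto_sectionTopology (h.continuous_norm_sections haar hφ)
      (IsTopologicalGroupoid.continuous_range.comp hq.fst).continuousAt fun ε hε => ?_
  obtain ⟨f, hf⟩ := (h.denseRange_sections haar hφ γ.source).exists_dist_lt u (half_pos hε)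
  obtain ⟨g, hg⟩ := (h.denseRange_sections haar hφ γ.range).exists_dist_lt
    (h.translation γ.hom (h.sections haar hφ f γ.source)) (half_pos hε)
  rw [dist_eq_norm] at hf hg
  have key : ∀ (γ' : Arr X) (u' : h.space γ'.source),
      ‖u' - h.sections haar hφ f γ'.source‖ < ε / 2 →
      ‖h.translation γ'.hom (h.sections haar hφ f γ'.source) -
        h.sections haar hφ g γ'.range‖ < ε / 2 →
      ‖h.translation γ'.hom u' - h.sections haar hφ g γ'.range‖ < ε := fun γ' u' h1 h2 => by
    rw [← (h.translation γ'.hom).norm_map, map_sub] at h1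
    rw [← sub_add_sub_cancel]
    exact (norm_add_le _ _).trans_lt ((add_lt_add h1 h2).trans_eq (add_halves ε))
  refine ⟨g, key γ u hf hg, ?_⟩
  filter_upwards [((continuous_dist_sectionTopology (h.sections haar hφ) f).comp
    hq.snd).continuousAt.eventually_lt continuousAt_const hf,
    ((h.continuous_norm_translation_sub_sections haar hφ f g).comp
      hq.fst).continuousAt.eventually_lt continuousAt_const hg] with q h1 h2
  exact key _ _ h1 h2

/-- The `G`-Hilbert bundle of a continuous function of positive type. -/
noncomputable def bundle : GHilbertBundle.{u, v, max u v} X where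
  toHilbertBundle :=
    have := IsTopologicalGroupoid.t2Space (X := X)
    HilbertBundle.ofSections (h.sections haar hφ) (h.denseRange_sections haar hφ)
      (h.continuous_norm_sections haar hφ)
  L γ := h.translation γ
  L_unit := h.translation_id
  L_mul := h.translation_comp
  continuous_action := h.continuous_translation haar hφ

/-- The canonical section of the bundle of a continuous function of positive type. -/
noncomputable def unitSection (x : X) : (h.bundle haar hφ).fiber x :=
  h.vec x ⟨x, 𝟙 x⟩

lemma L_unitSection {x : X} (γ : RangeFiber x) :
    (h.bundle haar hφ).L γ.hom (h.unitSection haar hφ γ.source) = h.vec x γ := by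
  refine (h.translation_vec γ.hom _).trans ?_
  simp [RangeFiber.translate]

lemma represents_bundle : Represents φ (h.bundle haar hφ) (h.unitSection haar hφ) := by
  refine ⟨?_, fun γ => ?_⟩
  · refine continuous_sectionTopology (h.sections haar hφ) continuous_id fun f => ?_
    -- Here `‖e(x)‖² = φ(x)` and `(e(x) | a_x(γ)) = φ(γ)`, both continuous.
    refine haar.continuous_norm_sub_integralSection hφ (h.continuous_vec hφ) h.inner_vec
      (p := fun x => x) continuous_id (b := fun x => h.vec x ⟨x, 𝟙 x⟩) ?_ ?_ f
    · simp only [@norm_eq_sqrt_re_inner ℂ, inner_vec, invMul]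
      exact (Complex.continuous_re.comp (hφ.comp
        (IsTopologicalGroupoid.continuous_unit.toArr_comp
          IsTopologicalGroupoid.continuous_unit.toArr_inv))).sqrt
    · simp only [inner_vec, invMul]
      exact hφ.comp (PullbackArr.continuous_arr.toArr_comp
        (IsTopologicalGroupoid.continuous_unit.comp PullbackArr.continuous_pt).toArr_inv)
  · have h1 := h.L_unitSection haar hφ (⟨γ.source, γ.hom⟩ : RangeFiber γ.range)
    dsimp only at h1
    rw [h1]
    refine Eq.trans ?_ (h.inner_vec γ.range ⟨γ.range, 𝟙 _⟩ ⟨γ.source, γ.hom⟩).symm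
    simp [invMul, toArr]

lemma isTotalSection_bundle : IsTotalSection (h.bundle haar hφ) (h.unitSection haar hφ) := by
  intro x
  refine (h.dense_span_vec x).mono (Submodule.span_mono ?_)
  rintro _ ⟨γ, rfl⟩
  exact ⟨γ, h.L_unitSection haar hφ γ⟩

end IsPositiveType

/-! ### Bundles representing a function -/

section Represents

variable {X : Type u} [TopologicalSpace X]

/-- Polarization reduces the inner product to norms of `a ± b` and `a ± i b`, which the bundle
axioms control. -/
lemma HilbertBundle.continuous_inner (E : HilbertBundle.{u, w} X) {T : Type*} [TopologicalSpace T]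
    {p : T → X} {a b : ∀ t, E.fiber (p t)}
    (ha : Continuous fun t => (⟨p t, a t⟩ : BundleSpace E.fiber))
    (hb : Continuous fun t => (⟨p t, b t⟩ : BundleSpace E.fiber)) :
    Continuous fun t => (inner ℂ (a t) (b t) : ℂ) := by
  have hadd : ∀ {c : ∀ t, E.fiber (p t)},
      Continuous (fun t => (⟨p t, c t⟩ : BundleSpace E.fiber)) →
      Continuous fun t => ‖a t + c t‖ := fun {c} hc => by
    let : TopologicalSpace (Σ x : X, E.fiber x × E.fiber x) := TopologicalSpace.induced
      (fun q => ((⟨q.1, q.2.1⟩, ⟨q.1, q.2.2⟩) : BundleSpace E.fiber × BundleSpace E.fiber))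
      inferInstance
    exact E.continuous_norm.comp (E.continuous_add.comp
      (f := fun t => (⟨p t, a t, c t⟩ : Σ x : X, E.fiber x × E.fiber x))
      (continuous_induced_rng.2 (ha.prodMk hc)))
  have hsmul : ∀ z : ℂ, Continuous fun t => ‖a t + z • b t‖ :=
    fun z => hadd ((E.continuous_smul z).comp hb)
  have h1 := hsmul 1
  have h2 := hsmul (-1)
  have h3 := hsmul Complex.I
  have h4 := hsmul (-Complex.I)
  simp only [neg_smul, one_smul, ← sub_eq_add_neg] at h1 h2 h3 h4
  simp only [inner_eq_sum_norm_sq_div_four, RCLike.I_to_complex]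
  fun_prop

variable [Groupoid.{v} X] [TopologicalSpace (Arr X)] {φ : Arr X → ℂ}

/-- Cancel the isometry `L(γ)` in `L(γ') = L(γ) L(γ⁻¹γ')`. -/
lemma Represents.inner_eq {E : GHilbertBundle.{u, v, w} X} {e : ∀ x, E.fiber x}
    (hE : Represents φ E e) (x : X) (γ γ' : RangeFiber x) :
    inner ℂ (E.L γ.hom (e γ.source)) (E.L γ'.hom (e γ'.source)) = φ (invMul γ γ') := by
  rw [hE.2]
  refine Eq.trans ?_ ((E.L γ.hom).inner_map_map _ _)
  refine congrArg _ ?_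
  refine Eq.trans ?_ (E.L_mul γ.hom (γ'.hom ≫ Groupoid.inv γ.hom) (e γ'.source))
  simp

lemma Represents.isPositiveType {E : GHilbertBundle.{u, v, w} X} {e : ∀ x, E.fiber x}
    (hE : Represents φ E e) : IsPositiveType φ :=
  fun x => isPositiveTypeKernel_inner (fun γ : RangeFiber x => E.L γ.hom (e γ.source))
    fun γ γ' => (hE.inner_eq x γ γ').symm

lemma GHilbertBundle.continuous_L {E : GHilbertBundle.{u, v, w} X} {e : ∀ x, E.fiber x}
    (he : IsContinuousSection E.toHilbertBundle e) (hs : Continuous fun γ : Arr X => γ.source) :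
    Continuous fun γ : Arr X => (⟨γ.range, E.L γ.hom (e γ.source)⟩ : BundleSpace E.fiber) := by
  let : TopologicalSpace (Σ γ : Arr X, E.fiber γ.source) := TopologicalSpace.induced
    (fun q => ((q.1, ⟨q.1.source, q.2⟩) : Arr X × BundleSpace E.fiber)) inferInstance
  exact E.continuous_action.comp
    (f := fun γ => (⟨γ, e γ.source⟩ : Σ γ : Arr X, E.fiber γ.source))
    (continuous_induced_rng.2 (continuous_id.prodMk (he.comp hs)))

variable [IsTopologicalGroupoid X] [LocallyCompactSpace (Arr X)] [T2Space (Arr X)]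
  [NormalSpace (Arr X)]

/-- Fibrewise isometries that match the translates of the given sections are continuous. -/
lemma Represents.continuous_map (haar : HaarSystem X) (hφ : Continuous φ)
    {E : GHilbertBundle.{u, v, w₁} X} {e : ∀ x, E.fiber x} {E' : GHilbertBundle.{u, v, w₂} X}
    {e' : ∀ x, E'.fiber x} (hE : Represents φ E e) (hE' : Represents φ E' e')
    (ht' : IsTotalSection E' e') (U : ∀ x, E.fiber x →ₗᵢ[ℂ] E'.fiber x)
    (hU : ∀ x (γ : RangeFiber x), U x (E.L γ.hom (e γ.source)) = E'.L γ.hom (e' γ.source)) :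
    Continuous
      (fun p : BundleSpace E.fiber => (⟨p.pt, U p.pt p.vec⟩ : BundleSpace E'.fiber)) := by
  have ha := fun x => continuous_of_inner_eq hφ (hE.inner_eq x)
  have ha' := fun x => continuous_of_inner_eq hφ (hE'.inner_eq x)
  have hN := haar.continuous_norm_sub_integralSection hφ ha hE.inner_eq E.continuous_proj
    (b := fun p => p.vec) E.continuous_norm (E.continuous_inner
      (p := fun q : PullbackArr (fun p : BundleSpace E.fiber => p.pt) => q.pt.pt)
      (b := fun q => E.L q.arr.hom (e q.arr.source)) PullbackArr.continuous_pt
      ((GHilbertBundle.continuous_L hE.1 IsTopologicalGroupoid.continuous_source).comp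
        PullbackArr.continuous_arr))
  have hN' := haar.continuous_norm_sub_integralSection hφ ha' hE'.inner_eq E'.continuous_proj
    (b := fun p => p.vec) E'.continuous_norm (E'.continuous_inner
      (p := fun q : PullbackArr (fun p : BundleSpace E'.fiber => p.pt) => q.pt.pt)
      (b := fun q => E'.L q.arr.hom (e' q.arr.source)) PullbackArr.continuous_pt
      ((GHilbertBundle.continuous_L hE'.1 IsTopologicalGroupoid.continuous_source).comp
        PullbackArr.continuous_arr))
  -- In the section topology of `E'`, only the distances to the integrated sections have to be
  -- checked.
  rw [E'.topology_eq_sectionTopology (haar.integralSection ha')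
    (fun x => haar.denseRange_integralSection ha' x (ht' x)) hN']
  refine continuous_sectionTopology _ E.continuous_proj fun f => ?_
  -- `U` commutes with integration, so it matches the two integrated sections of the same `f`; being
  -- isometric, it preserves the distances to them.
  have hUf : ∀ x, U x (haar.integralSection ha f x) = haar.integralSection ha' f x := fun x => by
    refine ((U x).toContinuousLinearMap.integral_comp_comm
      (haar.integrable_smul f (ha x))).symm.trans ?_
    refine integral_congr_ae (ae_of_all _ fun γ => ?_)
    simp [hU]
  simp only [← hUf, ← map_sub, LinearIsometry.norm_map]
  exact hN f

/-- Everything is tested on the total families `L(γ) e(s(γ))`; an equivariant isometry with `e ↦ e'`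
has prescribed values there, whence uniqueness. -/
lemma Represents.existsUnique_iso (haar : HaarSystem X) (hφ : Continuous φ)
    {E : GHilbertBundle.{u, v, w₁} X} {e : ∀ x, E.fiber x} {E' : GHilbertBundle.{u, v, w₂} X}
    {e' : ∀ x, E'.fiber x} (hE : Represents φ E e) (ht : IsTotalSection E e)
    (hE' : Represents φ E' e') (ht' : IsTotalSection E' e') :
    ∃! U : GHilbertBundle.Iso E E', ∀ x, U.map x (e x) = e' x := by
  choose U hU using fun x => exists_linearIsometryEquiv (ht x) (ht' x) fun γ γ' =>
    (hE'.inner_eq x γ γ').trans (hE.inner_eq x γ γ').symm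
  refine ⟨⟨U, ?_, ?_, ?_⟩, fun x => ?_, fun V hV => ?_⟩
  · exact hE.continuous_map haar hφ hE' ht' (fun x => (U x).toLinearIsometry) hU
  · refine hE'.continuous_map haar hφ hE ht (fun x => (U x).symm.toLinearIsometry) fun x γ => ?_
    exact (U x).symm_apply_eq.2 (hU x γ).symm
  · intro x y γ u
    refine LinearIsometry.eq_of_dense_span (ht x)
      (S := (U y).toLinearIsometry.comp (E.L γ)) (T := (E'.L γ).comp (U x).toLinearIsometry)
      (fun γ' => ?_) u
    have h1 : U y (E.L (γ'.hom ≫ γ) (e γ'.source)) = E'.L (γ'.hom ≫ γ) (e' γ'.source) :=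
      hU y (γ'.translate γ)
    rw [E.L_mul, E'.L_mul] at h1
    simp [hU, h1]
  · simpa [E.L_unit, E'.L_unit] using hU x ⟨x, 𝟙 x⟩
  · obtain ⟨V, hV1, hV2, hV3⟩ := V
    congr 1
    funext x
    refine LinearIsometryEquiv.ext fun u => LinearIsometry.eq_of_dense_span (ht x)
      (S := (V x).toLinearIsometry) (T := (U x).toLinearIsometry) (fun γ => ?_) u
    simp [hU, hV3, hV]

end Represents

theorem mainTheorem1 {X : Type u} [TopologicalSpace X] [Groupoid.{v} X] [TopologicalSpace (Arr X)]
    [IsTopologicalGroupoid X] [LocallyCompactSpace (Arr X)] [T2Space (Arr X)]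
    [SecondCountableTopology (Arr X)] (haar : HaarSystem X) (φ : Arr X → ℂ) (hφ : Continuous φ) :
    -- the three characterisations of positive type
    List.TFAE [
      IsPositiveType φ,
      ∀ (f : CompactlySupportedContinuousMap (Arr X) ℂ) (x : X),
        0 ≤ ∫ γ', ∫ γ, φ (invMul γ γ') * (starRingEnd ℂ) (f (toArr γ.hom)) * f (toArr γ'.hom)
          ∂(haar.measure x) ∂(haar.measure x),
      ∃ (E : GHilbertBundle.{u, v, max u v} X) (e : ∀ x, E.fiber x), Represents φ E e] ∧
    -- existence and uniqueness of the pair `(E, e)`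
    (IsPositiveType φ →
      (∃ (E : GHilbertBundle.{u, v, max u v} X) (e : ∀ x, E.fiber x),
        Represents φ E e ∧ IsTotalSection E e) ∧
      ∀ (E : GHilbertBundle.{u, v, w₁} X) (e : ∀ x, E.fiber x)
        (E' : GHilbertBundle.{u, v, w₂} X) (e' : ∀ x, E'.fiber x),
        Represents φ E e → IsTotalSection E e → Represents φ E' e' → IsTotalSection E' e' →
        ∃! U : GHilbertBundle.Iso E E', ∀ x, U.map x (e x) = e' x) := by
  -- Second countability gives normality, as Tietze extension requires.
  have : NormalSpace (Arr X) := NormalSpace.of_regularSpace_secondCountableTopology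
  refine ⟨?_, fun h => ⟨⟨h.bundle haar hφ, h.unitSection haar hφ, h.represents_bundle haar hφ,
    h.isTotalSection_bundle haar hφ⟩, fun E e E' e' hE ht hE' ht' =>
      hE.existsUnique_iso haar hφ ht hE' ht'⟩⟩
  tfae_have 1 → 2 := fun h f x => h.integral_nonneg haar hφ f x
  tfae_have 2 → 1 := isPositiveType_of_integral_nonneg haar hφ
  tfae_have 1 → 3 := fun h => ⟨_, _, h.represents_bundle haar hφ⟩
  tfae_have 3 → 1 := fun ⟨_, _, hE⟩ => hE.isPositiveType
  tfae_finish
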